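/- Let $n\ge 1$, let $1<p_1,p_2<\infty$ and put $p=\frac{p_1p_2}{p_1+p_2}$, i.e. $\frac1p=\frac1{p_1}+\frac1{p_2}$. A weight is a measurable function on $\mathbb R^n$ with values in $(0,\infty)$ almost everywhere. For a weight $w$ and $0<q<\infty$, let $\|f\|_{L^q(w)}=\left(\int_{\mathbb R^n}|f|^q\,w\,dx\right)^{1/q}$ and $\|F\|_{L^{q,\infty}(w)}=\sup_{\lambda>0}\lambda\, w(\{x:|F(x)|>\lambda\})^{1/q}$, where $w(E)=\int_E w\,dx$. The bilinear maximal function is $$\mathsf{BM}(f,g)(x)=\sup_{r>0}\frac1{(2r)^n}\int_{[-r,r]^n}|f(x-y)\,g(x+y)|\,dy .$$ Suppose that the weights $w_1,w_2$ satisfy $$\sup_Q\left(\frac1{|Q|}\int_Q w_1^{\frac p{p_1}}w_2^{\frac p{p_2}}\,dx\right)^{\frac1p}\left(\frac1{|Q|}\int_Q w_1^{\frac1{1-p}}\,dx\right)^{\frac{p-1}{p_1}}\left(\frac1{|Q|}\int_Q w_2^{\frac1{1-p}}\,dx\right)^{\frac{p-1}{p_2}}<\infty ,$$ where the supremum is over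 all cubes $Q\subset\mathbb R^n$ with sides parallel to the axes and where, if $p=1$, the factor $\left(\frac1{|Q|}\int_Q w_i^{\frac1{1-p}}\,dx\right)^{\frac{p-1}{p_i}}$ is read as $\left(\operatorname{ess\,inf}_Q w_i\right)^{-1/p_i}$. Then: (i) If $p\ge1$, then $\mathsf{BM}$ is bounded from $L^{p_1}(w_1)\times L^{p_2}(w_2)$ to $L^{p,\infty}\bigl(w_1^{p/p_1}w_2^{p/p_2}\bigr)$: there is a constant $C<\infty$ such that for all $f\in L^{p_1}(w_1)$ and $g\in L^{p_2}(w_2)$ $$\|\mathsf{BM}(f,g)\|_{L^{p,\infty}(w_1^{p/p_1}w_2^{p/p_2})}\le C\,\|f\|_{L^{p_1}(w_1)}\|g\|_{L^{p_2}(w_2)} .$$ (ii) If $p>1$, then $\mathsf{BM}$ is bounded from $L^{p_1}(w_1)\times L^{p_2}(w_2)$ to $L^{p}\bigl(w_1^{p/p_1}w_2^{p/p_2}\bigr)$: there is a constant $C<\infty$ such that for all $f\in L^{p_1}(w_1)$ and $g\in L^{p_2}(w_2)$ $$\|\mathsf{BM}(f,g)\|_{L^{p}(w_1^{p/p_1}w_2^{p/p_2})}\le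 C\,\|f\|_{L^{p_1}(w_1)}\|g\|_{L^{p_2}(w_2)} .$$ -/

import Mathlib

open MeasureTheory Set
open scoped ENNReal NNReal

noncomputable section

namespace BilinearMax

/-- The closed axis-parallel cube in `ℝⁿ` with lower corner `a` and side length `l`. -/
def cube {n : ℕ} (a : Fin n → ℝ) (l : ℝ) : Set (Fin n → ℝ) :=
  Set.Icc a (fun i => a i + l)

/-- A weight on `ℝⁿ`: a (Lebesgue) measurable function with values in `(0, ∞)` almost everywhere.
Local integrability is not required. -/
structure IsWeight {n : ℕ} (w : (Fin n → ℝ) → ℝ≥0∞) : Prop where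
  aemeasurable : AEMeasurable w volume
  pos : ∀ᵐ x ∂(volume : Measure (Fin n → ℝ)), 0 < w x
  lt_top : ∀ᵐ x ∂(volume : Measure (Fin n → ℝ)), w x < ∞

/-- The measure `w(x) dx`; thus `L^q(w)` is the `L^q` space of this measure. -/
def weightMeasure {n : ℕ} (w : (Fin n → ℝ) → ℝ≥0∞) : Measure (Fin n → ℝ) :=
  (volume : Measure (Fin n → ℝ)).withDensity w

/-- The weight `w₁^(p/p₁) w₂^(p/p₂)`. -/
def productWeight {n : ℕ} (p p₁ p₂ : ℝ) (w₁ w₂ : (Fin n → ℝ) → ℝ≥0∞) :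
    (Fin n → ℝ) → ℝ≥0∞ :=
  fun x => w₁ x ^ (p / p₁) * w₂ x ^ (p / p₂)

/-- The factor `(⨍_Q w^(1/(1-p)))^((p-1)/q)`, which for `p = 1` is read as
`(ess inf_Q w)^(-1/q)`. -/
def dualFactor {n : ℕ} (p q : ℝ) (w : (Fin n → ℝ) → ℝ≥0∞) (Q : Set (Fin n → ℝ)) : ℝ≥0∞ :=
  if p = 1 then (essInf w (volume.restrict Q)) ^ (-(1 / q))
  else (⨍⁻ x in Q, w x ^ (1 / (1 - p)) ∂volume) ^ ((p - 1) / q)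

/-- The supremum over all cubes `Q` of
`(⨍_Q w₁^(p/p₁) w₂^(p/p₂))^(1/p) (⨍_Q w₁^(1/(1-p)))^((p-1)/p₁) (⨍_Q w₂^(1/(1-p)))^((p-1)/p₂)`. -/
def vectorWeightConst {n : ℕ} (p p₁ p₂ : ℝ) (w₁ w₂ : (Fin n → ℝ) → ℝ≥0∞) : ℝ≥0∞ :=
  ⨆ (a : Fin n → ℝ) (l : ℝ) (_ : 0 < l),
    (⨍⁻ x in cube a l, productWeight p p₁ p₂ w₁ w₂ x ∂volume) ^ (1 / p)
      * dualFactor p p₁ w₁ (cube a l) * dualFactor p p₂ w₂ (cube a l)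

/-- The bilinear maximal function
`BM(f,g)(x) = sup_{r>0} (2r)^(-n) ∫_{[-r,r]^n} |f(x-y) g(x+y)| dy`. -/
def BM {n : ℕ} (f g : (Fin n → ℝ) → ℂ) (x : Fin n → ℝ) : ℝ≥0∞ :=
  ⨆ (r : ℝ) (_ : 0 < r), ENNReal.ofReal (1 / (2 * r) ^ n) *
    ∫⁻ y in Set.Icc (fun _ : Fin n => -r) (fun _ : Fin n => r), ‖f (x - y) * g (x + y)‖ₑ

/-- The weak `L^{p,∞}(μ)` quasinorm `sup_{t>0} t μ({F > t})^(1/p)` of a function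
`F` with values in `[0,∞]`. -/
def weakNorm {α : Type*} [MeasurableSpace α] (F : α → ℝ≥0∞) (p : ℝ) (μ : Measure α) : ℝ≥0∞ :=
  ⨆ (t : ℝ≥0) (_ : 0 < t), (t : ℝ≥0∞) * μ {x | (t : ℝ≥0∞) < F x} ^ (1 / p)

end BilinearMax

end

noncomputable section

namespace BilinearMax

open Metric

/-! As `y` runs over a cube centred at the origin, `x - y` and `x + y` run over the same cube about
`x`. Hölder with exponents `p₁ / p` and `p₂ / p` therefore bounds the bilinear mean by `geomMean`,
the weighted geometric mean of the averages of `F = |f|^(p₁/p)` and `G = |g|^(p₂/p)` over that cube.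
The `L^p(w₁)` and `L^p(w₂)` norms of `F` and `G` recover the norms of `f` and `g`, so the problem
resembles a one-function maximal estimate in which every quantity is a geometric mean.

Weak type: Hölder against `wᵢ` and the weight condition control the mass of each cube
(`weightMeasure_mul_geomMean_rpow_le`). The Besicovitch covering theorem and Hölder for sums then
add up these local bounds (`exists_measure_le_of_forall_closedBall_le`).

Strong type: with `σᵢ = wᵢ^(1/(1-p))` and `w` the product weight, the weight condition dominates the
`(p-1)`-st power of the geometric mean by the centred maximal function, with respect to `w`, of
`dualMax^(p-1) / w` (`geomMean_rpow_le_centeredMax`). By Besicovitch, centred maximal functions are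
bounded on `L^q(μ)` for `q > 1` uniformly in `μ` (`exists_lintegral_centeredMax_rpow_le`). This is
used with `q = p/(p-1)` for `w` and with `q = p` for `σ₁`, `σ₂`; no doubling is needed. -/

/-- Hölder's inequality for countable sums, with exponents `θ` and `1 - θ`. -/
theorem tsum_rpow_mul_rpow_le {ι : Type*} [Countable ι] (a b : ι → ℝ≥0∞) {θ : ℝ} (h0 : 0 ≤ θ)
    (h1 : θ ≤ 1) :
    ∑' i, a i ^ θ * b i ^ (1 - θ) ≤ (∑' i, a i) ^ θ * (∑' i, b i) ^ (1 - θ) := by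
  let _ : MeasurableSpace ι := ⊤
  have := ENNReal.lintegral_mul_norm_pow_le (μ := Measure.count) (f := a) (g := b)
    measurable_from_top.aemeasurable measurable_from_top.aemeasurable h0 (sub_nonneg.2 h1)
    (by ring)
  simpa [lintegral_count] using this

/-! ### Besicovitch covering and geometric means of measures -/

section Covering

variable (α : Type*) [MetricSpace α] [SecondCountableTopology α] [MeasurableSpace α]
  [OpensMeasurableSpace α] [HasBesicovitchCovering α]

/-- If every point of `S` is the centre of a ball on which `μ` is controlled by a geometric mean of
`ν₁` and `ν₂`, then so is `μ S`, up to a constant depending only on the space. -/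
theorem exists_measure_le_of_forall_closedBall_le :
    ∃ N : ℕ, ∀ (μ ν₁ ν₂ : Measure α) (θ : ℝ), 0 ≤ θ → θ ≤ 1 → ∀ (C : ℝ≥0∞) (S : Set α),
      (∀ x ∈ S, ∃ r : ℝ, 0 < r ∧ μ (closedBall x r) ≤
        C * (ν₁ (closedBall x r) ^ θ * ν₂ (closedBall x r) ^ (1 - θ))) →
      μ S ≤ N * (C * (ν₁ univ ^ θ * ν₂ univ ^ (1 - θ))) := by
  -- `N` is the number of disjoint families in the Besicovitch theorem; it is fixed before any
  -- measure is chosen.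
  obtain ⟨N, τ, hτ, hN⟩ := HasBesicovitchCovering.no_satelliteConfig (α := α)
  refine ⟨N, fun μ ν₁ ν₂ θ h0 h1 C S hS => ?_⟩
  -- The covering theorem needs bounded radii; the bound `R` does not enter the estimate and is
  -- removed by exhaustion.
  have key : ∀ (R : ℝ) (T : Set α), (∀ x ∈ T, ∃ r : ℝ, 0 < r ∧ r ≤ R ∧ μ (closedBall x r) ≤
        C * (ν₁ (closedBall x r) ^ θ * ν₂ (closedBall x r) ^ (1 - θ))) →
      μ T ≤ N * (C * (ν₁ univ ^ θ * ν₂ univ ^ (1 - θ))) := by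
    intro R T hT
    choose! r hr0 hrR hr using hT
    let q : Besicovitch.BallPackage T α :=
      { c := fun x => x
        r := fun x => r x
        rpos := fun x => hr0 x x.2
        r_bound := R
        r_le := fun x => hrR x x.2 }
    obtain ⟨s, hs, hcov⟩ := Besicovitch.exist_disjoint_covering_families hτ hN q
    have hcount : ∀ i, (s i).Countable := fun i =>
      (hs i).countable_of_nonempty_interior fun j _ =>
        ⟨q.c j, ball_subset_interior_closedBall (mem_ball_self (q.rpos j))⟩
    have hsub : T ⊆ ⋃ i : Fin N, ⋃ j ∈ s i, closedBall (q.c j) (q.r j) := by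
      intro x hx
      have := hcov ⟨⟨x, hx⟩, rfl⟩
      simp only [mem_iUnion] at this ⊢
      obtain ⟨i, j, hj, hxj⟩ := this
      exact ⟨i, j, hj, ball_subset_closedBall hxj⟩
    -- Each family is disjoint, so its total mass does not exceed that of the whole space.
    have hfam : ∀ (ν : Measure α) (i : Fin N),
        ∑' j : s i, ν (closedBall (q.c j) (q.r j)) ≤ ν univ := by
      intro ν i
      rw [← measure_biUnion (hcount i) (hs i) fun _ _ => measurableSet_closedBall]
      exact measure_mono (subset_univ _)
    calc μ T ≤ ∑ i : Fin N, μ (⋃ j ∈ s i, closedBall (q.c j) (q.r j)) :=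
          (measure_mono hsub).trans (measure_iUnion_fintype_le _ _)
      _ ≤ ∑ _i : Fin N, C * (ν₁ univ ^ θ * ν₂ univ ^ (1 - θ)) := by
          refine Finset.sum_le_sum fun i _ => ?_
          have := (hcount i).to_subtype
          calc μ (⋃ j ∈ s i, closedBall (q.c j) (q.r j))
              ≤ ∑' j : s i, μ (closedBall (q.c j) (q.r j)) := measure_biUnion_le _ (hcount i) _
            _ ≤ ∑' j : s i, C * (ν₁ (closedBall (q.c j) (q.r j)) ^ θ *
                  ν₂ (closedBall (q.c j) (q.r j)) ^ (1 - θ)) :=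
                ENNReal.tsum_le_tsum fun j => hr _ j.1.2
            _ ≤ C * ((∑' j : s i, ν₁ (closedBall (q.c j) (q.r j))) ^ θ *
                  (∑' j : s i, ν₂ (closedBall (q.c j) (q.r j))) ^ (1 - θ)) := by
                rw [ENNReal.tsum_mul_left]
                gcongr
                exact tsum_rpow_mul_rpow_le _ _ h0 h1
            _ ≤ _ := by
                have := sub_nonneg.2 h1
                gcongr <;> exact hfam _ i
      _ = _ := by simp
  let T : ℕ → Set α := fun R => {x ∈ S | ∃ r : ℝ, 0 < r ∧ r ≤ R ∧ μ (closedBall x r) ≤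
        C * (ν₁ (closedBall x r) ^ θ * ν₂ (closedBall x r) ^ (1 - θ))}
  have hTmono : Monotone T := by
    rintro m k hmk x ⟨hx, r, h, h', h''⟩
    exact ⟨hx, r, h, h'.trans (by exact_mod_cast hmk), h''⟩
  have hTS : S ⊆ ⋃ R, T R := by
    intro x hx
    obtain ⟨r, hr, hr'⟩ := hS x hx
    obtain ⟨R, hR⟩ := exists_nat_ge r
    exact mem_iUnion.2 ⟨R, hx, r, hr, hR, hr'⟩
  calc μ S ≤ μ (⋃ R, T R) := measure_mono hTS
    -- Continuity along increasing unions holds for arbitrary sets, so `S` need not be measurable.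
    _ = ⨆ R, μ (T R) := hTmono.measure_iUnion
    _ ≤ _ := iSup_le fun R => key R (T R) fun x hx => hx.2

end Covering

/-! ### Layer cake formulas -/

/-- Layer cake formula for a single extended nonnegative number. -/
theorem setLIntegral_rpow_sub_one (a : ℝ≥0∞) {q : ℝ} (hq : 0 < q) :
    ∫⁻ t in {t : ℝ | 0 < t ∧ ENNReal.ofReal t < a}, ENNReal.ofReal (t ^ (q - 1)) =
      ENNReal.ofReal q⁻¹ * a ^ q := by
  have fin : ∀ s : ℝ, 0 ≤ s → ∫⁻ t in Ioo 0 s, ENNReal.ofReal (t ^ (q - 1)) =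
      ENNReal.ofReal q⁻¹ * ENNReal.ofReal s ^ q := by
    intro s hs
    rw [ENNReal.ofReal_rpow_of_nonneg hs hq.le, ← ENNReal.ofReal_mul (by positivity),
      ← ofReal_integral_eq_lintegral_ofReal]
    · rw [← integral_Ioc_eq_integral_Ioo, ← intervalIntegral.integral_of_le hs,
        integral_rpow (Or.inl (by linarith))]
      simp only [sub_add_cancel, Real.zero_rpow hq.ne', sub_zero]
      rw [div_eq_inv_mul]
    · have := (intervalIntegral.intervalIntegrable_rpow' (a := 0) (b := s)
        (r := q - 1) (by linarith)).1
      exact this.mono_set Ioo_subset_Ioc_self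
    · filter_upwards [ae_restrict_mem measurableSet_Ioo] with t ht
      exact Real.rpow_nonneg ht.1.le _
  rcases eq_or_ne a ∞ with rfl | ha
  -- For `a = ∞` the integral exceeds every truncated one, and those tend to infinity.
  · rw [ENNReal.top_rpow_of_pos hq, ENNReal.mul_top (by simpa using hq)]
    refine ENNReal.eq_top_of_forall_nnreal_le fun r => ?_
    have hlim : Filter.Tendsto (fun s : ℝ => ENNReal.ofReal (q⁻¹ * s ^ q)) Filter.atTop
        (nhds ∞) := by
      refine ENNReal.tendsto_ofReal_atTop.comp ?_
      exact (tendsto_rpow_atTop hq).const_mul_atTop (by positivity)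
    obtain ⟨s, hs, hs0⟩ := ((hlim.eventually (lt_mem_nhds (ENNReal.coe_lt_top (r := r)))).and
      (Filter.eventually_ge_atTop 0)).exists
    rw [ENNReal.ofReal_mul (by positivity), ← ENNReal.ofReal_rpow_of_nonneg hs0 hq.le,
      ← fin s hs0] at hs
    refine hs.le.trans (lintegral_mono_set fun t ht => ⟨ht.1, ENNReal.ofReal_lt_top⟩)
  · lift a to ℝ≥0 using ha
    have : {t : ℝ | 0 < t ∧ ENNReal.ofReal t < a} = Ioo 0 (a : ℝ) := by
      ext t
      simp only [mem_ofPred_eq, mem_Ioo, and_congr_right_iff]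
      intro ht
      rw [← ENNReal.ofReal_coe_nnreal, ENNReal.ofReal_lt_ofReal_iff_of_nonneg ht.le]
    rw [this, fin a a.coe_nonneg, ENNReal.ofReal_coe_nnreal]

/-- The layer cake formula for `∫ h F^q`. -/
theorem lintegral_mul_rpow_eq {α : Type*} [MeasurableSpace α] {μ : Measure α} [SFinite μ]
    {F h : α → ℝ≥0∞} (hF : Measurable F) (hh : Measurable h) {q : ℝ} (hq : 0 < q) :
    ENNReal.ofReal q⁻¹ * ∫⁻ x, h x * F x ^ q ∂μ = ∫⁻ t in Ioi (0 : ℝ),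
      ENNReal.ofReal (t ^ (q - 1)) * ∫⁻ x in {x | ENNReal.ofReal t < F x}, h x ∂μ := by
  have hms : MeasurableSet {z : α × ℝ | ENNReal.ofReal z.2 < F z.1} :=
    measurableSet_lt (by fun_prop) (by fun_prop)
  have hleft : ∀ x, ENNReal.ofReal q⁻¹ * (h x * F x ^ q) = ∫⁻ t in Ioi (0 : ℝ),
      {z : α × ℝ | ENNReal.ofReal z.2 < F z.1}.indicator
        (fun z => ENNReal.ofReal (z.2 ^ (q - 1)) * h z.1) (x, t) := by
    intro x
    have hset : MeasurableSet {t : ℝ | ENNReal.ofReal t < F x} :=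
      measurableSet_lt (by fun_prop) (by fun_prop)
    have : ∀ t : ℝ, {z : α × ℝ | ENNReal.ofReal z.2 < F z.1}.indicator
        (fun z => ENNReal.ofReal (z.2 ^ (q - 1)) * h z.1) (x, t) =
        {t : ℝ | ENNReal.ofReal t < F x}.indicator
          (fun t => ENNReal.ofReal (t ^ (q - 1)) * h x) t := fun t => rfl
    simp_rw [this]
    rw [lintegral_indicator hset, Measure.restrict_restrict hset,
      lintegral_mul_const _ (by fun_prop), mul_left_comm, ← setLIntegral_rpow_sub_one _ hq,
      mul_comm]
    congr 3
    ext t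
    simp [and_comm]
  rw [← lintegral_const_mul _ (by fun_prop)]
  simp_rw [hleft]
  rw [lintegral_lintegral_swap]
  · refine setLIntegral_congr_fun measurableSet_Ioi fun t _ => ?_
    have hset : MeasurableSet {x : α | ENNReal.ofReal t < F x} :=
      measurableSet_lt (by fun_prop) (by fun_prop)
    have : ∀ x : α, {z : α × ℝ | ENNReal.ofReal z.2 < F z.1}.indicator
        (fun z => ENNReal.ofReal (z.2 ^ (q - 1)) * h z.1) (x, t) =
        {x : α | ENNReal.ofReal t < F x}.indicator
          (fun x => ENNReal.ofReal (t ^ (q - 1)) * h x) x := fun x => rfl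
    simp_rw [this]
    rw [lintegral_indicator hset, lintegral_const_mul _ hh]
  · exact (Measurable.indicator (by fun_prop) hms).aemeasurable

/-! ### Centred maximal functions for arbitrary measures -/

section CenteredMax

variable {α : Type*} [MetricSpace α] [MeasurableSpace α]

/-- The maximal function of `h` with respect to `μ` over centred balls of rational radius. -/
def centeredMax (μ : Measure α) (h : α → ℝ≥0∞) (x : α) : ℝ≥0∞ :=
  ⨆ (q : ℚ) (_ : 0 < q), (∫⁻ z in closedBall x q, h z ∂μ) / μ (closedBall x q)

theorem centeredMax_congr {μ : Measure α} {h h' : α → ℝ≥0∞} (hh : h =ᵐ[μ] h') :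
    centeredMax μ h = centeredMax μ h' := by
  funext x
  refine iSup_congr fun q => iSup_congr fun _ => ?_
  rw [lintegral_congr_ae (ae_restrict_of_ae hh)]

theorem setLIntegral_le_centeredMax_mul {μ : Measure α} (h : α → ℝ≥0∞) (x : α) {q : ℚ}
    (hq : 0 < q) (hfin : μ (closedBall x q) ≠ ∞) :
    ∫⁻ z in closedBall x q, h z ∂μ ≤ centeredMax μ h x * μ (closedBall x q) := by
  rcases eq_or_ne (μ (closedBall x q)) 0 with h0 | h0
  · rw [setLIntegral_measure_zero _ _ h0]
    exact zero_le
  · rw [← ENNReal.div_le_iff h0 hfin]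
    exact le_iSup₂ (f := fun (q : ℚ) (_ : 0 < q) =>
      (∫⁻ z in closedBall x q, h z ∂μ) / μ (closedBall x q)) q hq

variable [SecondCountableTopology α] [BorelSpace α]

theorem measurable_setLIntegral_closedBall {μ : Measure α} [SFinite μ] {h : α → ℝ≥0∞}
    (hh : AEMeasurable h μ) (r : ℝ) : Measurable fun x => ∫⁻ z in closedBall x r, h z ∂μ := by
  have hs : MeasurableSet {z : α × α | dist z.2 z.1 ≤ r} :=
    measurableSet_le (by fun_prop) (by fun_prop)
  have key : (fun x => ∫⁻ z in closedBall x r, h z ∂μ) = fun x => ∫⁻ z,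
      {z : α × α | dist z.2 z.1 ≤ r}.indicator (fun z => hh.mk h z.2) (x, z) ∂μ := by
    funext x
    rw [lintegral_congr_ae (ae_restrict_of_ae hh.ae_eq_mk),
      ← lintegral_indicator measurableSet_closedBall]
    rfl
  rw [key]
  refine Measurable.lintegral_prod_right' (f := {z : α × α | dist z.2 z.1 ≤ r}.indicator
    (fun z => hh.mk h z.2)) (Measurable.indicator ?_ hs)
  exact hh.measurable_mk.comp measurable_snd

theorem measurable_centeredMax {μ : Measure α} [SFinite μ] {h : α → ℝ≥0∞}
    (hh : AEMeasurable h μ) : Measurable (centeredMax μ h) := by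
  refine Measurable.iSup fun q => Measurable.iSup fun _ => ?_
  refine (measurable_setLIntegral_closedBall hh q).div ?_
  simpa using measurable_setLIntegral_closedBall (μ := μ) (h := 1) aemeasurable_const q

variable (α) [HasBesicovitchCovering α]

/-- The weak type estimate for the centred maximal function, in truncated form. -/
theorem exists_measure_centeredMax_le :
    ∃ N : ℕ, ∀ (μ : Measure α) (h : α → ℝ≥0∞), Measurable h → ∀ t : ℝ≥0∞, t ≠ 0 → t ≠ ∞ →
      μ {x | t < centeredMax μ h x} ≤
        N * (2 / t * ∫⁻ x in {x | t < 2 * h x}, h x ∂μ) := by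
  obtain ⟨N, hN⟩ := exists_measure_le_of_forall_closedBall_le α
  refine ⟨N, fun μ h hh t ht0 ht => ?_⟩
  have hs : MeasurableSet {x | t < 2 * h x} := measurableSet_lt (by fun_prop) (by fun_prop)
  -- Only the part of `h` above `t / 2` is kept; the rest contributes at most half of the required
  -- average.
  set ν : Measure α := μ.withDensity ({x | t < 2 * h x}.indicator h) with hν
  have := hN μ ν ν 1 zero_le_one le_rfl (2 / t) {x | t < centeredMax μ h x} ?_
  · simpa [hν, withDensity_apply, lintegral_indicator hs] using this
  intro x hx
  simp only [centeredMax, mem_ofPred_eq, lt_iSup_iff] at hx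
  obtain ⟨q, hq, hlt⟩ := hx
  refine ⟨q, by exact_mod_cast hq, ?_⟩
  simp only [ENNReal.rpow_one, sub_self, ENNReal.rpow_zero, mul_one]
  have hlt' := ENNReal.mul_lt_of_lt_div hlt
  -- Finiteness allows `t / 2 * μ (closedBall x q)` to be cancelled below.
  have hfin : μ (closedBall x q) ≠ ∞ := by
    intro htop
    rw [htop, ENNReal.mul_top ht0] at hlt'
    exact not_top_lt hlt'
  have hle : ∫⁻ z in closedBall x q, h z ∂μ ≤
      ν (closedBall x q) + t / 2 * μ (closedBall x q) := by
    rw [hν, withDensity_apply _ measurableSet_closedBall, ← setLIntegral_const,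
      ← lintegral_add_left (hh.indicator hs)]
    refine lintegral_mono fun z => ?_
    by_cases hz : t < 2 * h z
    · rw [indicator_of_mem (by exact hz)]
      exact le_self_add
    · refine le_trans ?_ le_add_self
      rw [ENNReal.le_div_iff_mul_le (by simp) (by simp), mul_comm]
      exact not_lt.1 hz
  have hsplit : t * μ (closedBall x q) =
      t / 2 * μ (closedBall x q) + t / 2 * μ (closedBall x q) := by
    rw [← add_mul, ENNReal.add_halves]
  have h2 : t / 2 * μ (closedBall x q) ≤ ν (closedBall x q) := by
    have h3 := hlt'.le.trans hle
    rw [hsplit] at h3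
    refine (ENNReal.add_le_add_iff_right (ENNReal.mul_ne_top ?_ hfin)).1 h3
    exact ENNReal.div_ne_top ht (by simp)
  have hinv : 2 / t * (t / 2) = 1 := by
    rw [← ENNReal.inv_div (by simp) (by simp), ENNReal.inv_mul_cancel]
    · simpa using ht0
    · exact ENNReal.div_ne_top ht (by simp)
  calc μ (closedBall x q) = 2 / t * (t / 2 * μ (closedBall x q)) := by
        rw [← mul_assoc, hinv, one_mul]
    _ ≤ _ := by gcongr

/-- The centred maximal function is bounded on `L^p(μ)` for `p > 1`, with a constant that does not
depend on `μ`. -/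
theorem exists_lintegral_centeredMax_rpow_le {p : ℝ} (hp : 1 < p) :
    ∃ C : ℝ≥0, ∀ (μ : Measure α) [SFinite μ] (h : α → ℝ≥0∞), AEMeasurable h μ →
      ∫⁻ x, centeredMax μ h x ^ p ∂μ ≤ C * ∫⁻ x, h x ^ p ∂μ := by
  obtain ⟨N, hN⟩ := exists_measure_centeredMax_le α
  have hp0 : 0 < p := by linarith
  have hp1 : 0 < p - 1 := by linarith
  -- The factor `p` undoes the layer cake on the left, `N * 2` is the weak type constant, and the
  -- rest comes from the layer cake for `2 * h` with exponent `p - 1`.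
  refine ⟨Real.toNNReal p * (N * (2 * (Real.toNNReal (p - 1)⁻¹ * 2 ^ (p - 1)))), ?_⟩
  intro μ _ h hh
  wlog hm : Measurable h generalizing h
  · have hpow : ∫⁻ x, h x ^ p ∂μ = ∫⁻ x, hh.mk h x ^ p ∂μ :=
      lintegral_congr_ae (hh.ae_eq_mk.fun_comp (· ^ p))
    rw [centeredMax_congr hh.ae_eq_mk, hpow]
    exact this _ hh.measurable_mk.aemeasurable hh.measurable_mk
  have hM := measurable_centeredMax hh
  have h1 := lintegral_mul_rpow_eq (μ := μ) hM (measurable_const (a := (1 : ℝ≥0∞))) hp0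
  -- Weighting by `h` makes the inner integral exactly the one in the truncated weak type estimate.
  have h2 := lintegral_mul_rpow_eq (μ := μ) (hm.const_mul 2) hm hp1
  have hpow : ∀ x, h x * (2 * h x) ^ (p - 1) = 2 ^ (p - 1) * h x ^ p := by
    intro x
    rw [ENNReal.mul_rpow_of_nonneg _ _ hp1.le, mul_left_comm]
    congr 1
    conv_rhs => rw [show p = 1 + (p - 1) by ring, ENNReal.rpow_add_of_nonneg _ _ zero_le_one hp1.le,
      ENNReal.rpow_one]
  simp only [one_mul, setLIntegral_one] at h1
  simp only [hpow] at h2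
  rw [lintegral_const_mul _ (by fun_prop)] at h2
  have hle : ENNReal.ofReal p⁻¹ * ∫⁻ x, centeredMax μ h x ^ p ∂μ ≤
      N * (2 * (ENNReal.ofReal (p - 1)⁻¹ * (2 ^ (p - 1) * ∫⁻ x, h x ^ p ∂μ))) := by
    rw [h1, h2, ← lintegral_const_mul' _ _ (by simp), ← lintegral_const_mul' _ _ (by simp)]
    refine setLIntegral_mono' measurableSet_Ioi fun t ht => ?_
    have ht' : ENNReal.ofReal t ≠ 0 := by simpa using ht
    have hsplit : ENNReal.ofReal (t ^ (p - 1)) =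
        ENNReal.ofReal (t ^ (p - 1 - 1)) * ENNReal.ofReal t := by
      rw [← ENNReal.ofReal_mul (Real.rpow_nonneg (le_of_lt ht) _)]
      congr 1
      conv_rhs => rw [← Real.rpow_one t, ← Real.rpow_mul (le_of_lt ht), one_mul]
      rw [← Real.rpow_add ht]
      congr 1
      ring
    calc ENNReal.ofReal (t ^ (p - 1)) * μ {x | ENNReal.ofReal t < centeredMax μ h x}
        ≤ ENNReal.ofReal (t ^ (p - 1)) * (N * (2 / ENNReal.ofReal t *
            ∫⁻ x in {x | ENNReal.ofReal t < 2 * h x}, h x ∂μ)) := by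
          gcongr
          exact hN μ h hm _ ht' ENNReal.ofReal_ne_top
      _ = (ENNReal.ofReal t * (ENNReal.ofReal t)⁻¹) * (N * (2 * (ENNReal.ofReal (t ^ (p - 1 - 1)) *
            ∫⁻ x in {x | ENNReal.ofReal t < 2 * h x}, h x ∂μ))) := by
          rw [hsplit, ENNReal.div_eq_inv_mul]
          ring
      _ = _ := by rw [ENNReal.mul_inv_cancel ht' ENNReal.ofReal_ne_top, one_mul]
  have hone : ENNReal.ofReal p * ENNReal.ofReal p⁻¹ = 1 := by
    rw [← ENNReal.ofReal_mul hp0.le, mul_inv_cancel₀ hp0.ne', ENNReal.ofReal_one]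
  calc ∫⁻ x, centeredMax μ h x ^ p ∂μ
      = ENNReal.ofReal p * (ENNReal.ofReal p⁻¹ * ∫⁻ x, centeredMax μ h x ^ p ∂μ) := by
        rw [← mul_assoc, hone, one_mul]
    _ ≤ ENNReal.ofReal p *
        (N * (2 * (ENNReal.ofReal (p - 1)⁻¹ * (2 ^ (p - 1) * ∫⁻ x, h x ^ p ∂μ)))) := by gcongr
    _ = _ := by
        push_cast
        rw [ENNReal.coe_rpow_of_nonneg _ hp1.le]
        simp only [ENNReal.ofReal, ENNReal.coe_ofNat]
        ring

end CenteredMax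

/-! ### Cubes as sup-norm balls, and the bilinear means -/

section Geometry

variable {n : ℕ}

theorem closedBall_eq_Icc (x : Fin n → ℝ) {r : ℝ} (hr : 0 ≤ r) :
    closedBall x r = Icc (fun i => x i - r) (fun i => x i + r) := by
  rw [closedBall_pi _ hr]
  simp_rw [Real.closedBall_eq_Icc, pi_univ_Icc]

theorem closedBall_eq_cube (x : Fin n → ℝ) {r : ℝ} (hr : 0 ≤ r) :
    closedBall x r = cube (fun i => x i - r) (2 * r) := by
  rw [closedBall_eq_Icc x hr, cube]
  congr 1
  funext i
  ring

theorem volume_closedBall (x : Fin n → ℝ) {r : ℝ} (hr : 0 ≤ r) :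
    volume (closedBall x r) = ENNReal.ofReal ((2 * r) ^ n) := by
  simpa using Real.volume_pi_closedBall x hr

theorem volume_closedBall_ne_zero (x : Fin n → ℝ) {r : ℝ} (hr : 0 < r) :
    volume (closedBall x r) ≠ 0 :=
  (measure_closedBall_pos volume x hr).ne'

theorem volume_closedBall_ne_top (x : Fin n → ℝ) (r : ℝ) : volume (closedBall x r) ≠ ∞ :=
  measure_closedBall_lt_top.ne

theorem setLIntegral_closedBall_sub_left (F : (Fin n → ℝ) → ℝ≥0∞) (x : Fin n → ℝ) (r : ℝ) :
    ∫⁻ y in closedBall 0 r, F (x - y) = ∫⁻ y in closedBall x r, F y := by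
  rw [← lintegral_indicator measurableSet_closedBall, ← lintegral_indicator measurableSet_closedBall,
    ← lintegral_sub_left_eq_self ((closedBall x r).indicator F) x]
  congr 1
  funext y
  by_cases hy : y ∈ closedBall 0 r
  · have : x - y ∈ closedBall x r := by simpa [dist_eq_norm] using hy
    rw [indicator_of_mem hy, indicator_of_mem this]
  · have : x - y ∉ closedBall x r := by simpa [dist_eq_norm] using hy
    rw [indicator_of_notMem hy, indicator_of_notMem this]

theorem setLIntegral_closedBall_add_left (F : (Fin n → ℝ) → ℝ≥0∞) (x : Fin n → ℝ) (r : ℝ) :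
    ∫⁻ y in closedBall 0 r, F (x + y) = ∫⁻ y in closedBall x r, F y := by
  rw [← lintegral_indicator measurableSet_closedBall, ← lintegral_indicator measurableSet_closedBall,
    ← lintegral_add_left_eq_self ((closedBall x r).indicator F) x]
  congr 1
  funext y
  by_cases hy : y ∈ closedBall 0 r
  · have : x + y ∈ closedBall x r := by simpa [dist_eq_norm] using hy
    rw [indicator_of_mem hy, indicator_of_mem this]
  · have : x + y ∉ closedBall x r := by simpa [dist_eq_norm] using hy
    rw [indicator_of_notMem hy, indicator_of_notMem this]

/-- The mean of `|f(x-y) g(x+y)|` over the cube `|y| ≤ r`. -/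
def bilinearMean (f g : (Fin n → ℝ) → ℂ) (r : ℝ) (x : Fin n → ℝ) : ℝ≥0∞ :=
  ENNReal.ofReal (1 / (2 * r) ^ n) * ∫⁻ y in closedBall 0 r, ‖f (x - y) * g (x + y)‖ₑ

/-- Spheres are null, so the cube of radius `r` is exhausted by cubes of rational radius `q < r`,
whose normalising factors are at least as large. Countably many radii give measurability and match
`centeredMax`. -/
theorem BM_eq_iSup_bilinearMean (f g : (Fin n → ℝ) → ℂ) (x : Fin n → ℝ) :
    BM f g x = ⨆ (q : ℚ) (_ : 0 < q), bilinearMean f g q x := by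
  have hBM : BM f g x = ⨆ (r : ℝ) (_ : 0 < r), bilinearMean f g r x := by
    refine iSup_congr fun r => iSup_congr fun hr => ?_
    rw [bilinearMean, closedBall_eq_Icc 0 hr.le]
    simp
  rw [hBM]
  refine le_antisymm (iSup₂_le fun r hr => ?_) (iSup₂_le fun q hq =>
    le_iSup₂ (f := fun (r : ℝ) (_ : 0 < r) => bilinearMean f g r x) (q : ℝ) (by exact_mod_cast hq))
  have hball : ball (0 : Fin n → ℝ) r = ⋃ q : {q : ℚ // 0 < q ∧ (q : ℝ) < r}, closedBall 0 q := by
    ext y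
    simp only [mem_ball_zero_iff, mem_iUnion, mem_closedBall_zero_iff, Subtype.exists, exists_prop]
    constructor
    · intro hy
      obtain ⟨q, hq1, hq2⟩ := exists_rat_btwn hy
      exact ⟨q, ⟨by exact_mod_cast (norm_nonneg y).trans_lt hq1, hq2⟩, hq1.le⟩
    · rintro ⟨q, ⟨_, hq⟩, hy⟩
      exact hy.trans_lt hq
  have hae : closedBall (0 : Fin n → ℝ) r =ᵐ[volume] ball 0 r := by
    rw [← ball_union_sphere]
    exact union_ae_eq_left_of_ae_eq_empty
      (ae_eq_empty.2 (Measure.addHaar_sphere_of_ne_zero volume 0 hr.ne'))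
  have hdir : Directed (· ⊆ ·)
      (fun q : {q : ℚ // 0 < q ∧ (q : ℝ) < r} => closedBall (0 : Fin n → ℝ) (q : ℚ)) := by
    intro a b
    rcases le_total a b with h | h
    · exact ⟨b, closedBall_subset_closedBall (by exact_mod_cast h), subset_rfl⟩
    · exact ⟨a, subset_rfl, closedBall_subset_closedBall (by exact_mod_cast h)⟩
  rw [bilinearMean, setLIntegral_congr hae, hball, setLIntegral_iUnion_of_directed _ hdir,
    ENNReal.mul_iSup]
  refine iSup_le fun q => ?_
  have hq0 : (0 : ℝ) < (q : ℚ) := by exact_mod_cast q.2.1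
  refine le_trans ?_ (le_iSup₂ (f := fun (q : ℚ) (_ : 0 < q) => bilinearMean f g q x) q q.2.1)
  rw [bilinearMean]
  gcongr
  exact q.2.2.le

/-- Replacing `f` and `g` by measurable versions changes the mean at no point `x`, since reflections
and translations preserve null sets. -/
theorem measurable_bilinearMean {f g : (Fin n → ℝ) → ℂ} (hf : AEMeasurable f volume)
    (hg : AEMeasurable g volume) (r : ℝ) : Measurable (bilinearMean f g r) := by
  have key : bilinearMean f g r = bilinearMean (hf.mk f) (hg.mk g) r := by
    funext x
    have h1 := (quasiMeasurePreserving_sub_left volume x).ae_eq_comp hf.ae_eq_mk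
    have h2 := (measurePreserving_add_left volume x).quasiMeasurePreserving.ae_eq_comp hg.ae_eq_mk
    rw [bilinearMean, bilinearMean]
    congr 1
    refine lintegral_congr_ae (ae_restrict_of_ae ?_)
    filter_upwards [h1, h2] with y hy1 hy2
    simp only [Function.comp_apply] at hy1 hy2
    rw [hy1, hy2]
  rw [key]
  refine Measurable.const_mul (Measurable.lintegral_prod_right'
    (f := fun z : (Fin n → ℝ) × (Fin n → ℝ) => ‖hf.mk f (z.1 - z.2) * hg.mk g (z.1 + z.2)‖ₑ) ?_) _
  exact ((hf.measurable_mk.comp (measurable_fst.sub measurable_snd)).mul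
    (hg.measurable_mk.comp (measurable_fst.add measurable_snd))).enorm

theorem measurable_BM {f g : (Fin n → ℝ) → ℂ} (hf : AEMeasurable f volume)
    (hg : AEMeasurable g volume) : Measurable (BM f g) := by
  have : BM f g = fun x => ⨆ (q : ℚ) (_ : 0 < q), bilinearMean f g q x :=
    funext (BM_eq_iSup_bilinearMean f g)
  rw [this]
  exact Measurable.iSup fun q => Measurable.iSup fun _ => measurable_bilinearMean hf hg q

/-- Hölder in `y`, after which the reflection `x - y` and the translation `x + y` each carry the
cube about `0` to the cube about `x`. -/
theorem bilinearMean_le {f g : (Fin n → ℝ) → ℂ} (hf : AEMeasurable f volume)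
    (hg : AEMeasurable g volume) {r : ℝ} (hr : 0 < r) (x : Fin n → ℝ) {θ : ℝ} (h0 : 0 < θ)
    (h1 : θ < 1) :
    bilinearMean f g r x ≤ (⨍⁻ y in closedBall x r, ‖f y‖ₑ ^ θ⁻¹ ∂volume) ^ θ *
      (⨍⁻ y in closedBall x r, ‖g y‖ₑ ^ (1 - θ)⁻¹ ∂volume) ^ (1 - θ) := by
  have h1' : 0 < 1 - θ := sub_pos.2 h1
  have hV : ENNReal.ofReal (1 / (2 * r) ^ n) = (volume (closedBall x r))⁻¹ := by
    rw [volume_closedBall x hr.le, one_div, ENNReal.ofReal_inv_of_pos (by positivity)]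
  have hVpow : ∀ V : ℝ≥0∞, V = V ^ θ * V ^ (1 - θ) := by
    intro V
    rw [← ENNReal.rpow_add_of_nonneg _ _ h0.le h1'.le]
    simp
  have hfx : AEMeasurable (fun y => ‖f (x - y)‖ₑ ^ θ⁻¹) (volume.restrict (closedBall 0 r)) :=
    ((hf.comp_quasiMeasurePreserving
      (quasiMeasurePreserving_sub_left volume x)).enorm.pow_const _).restrict
  have hgx : AEMeasurable (fun y => ‖g (x + y)‖ₑ ^ (1 - θ)⁻¹)
      (volume.restrict (closedBall 0 r)) :=
    ((hg.comp_quasiMeasurePreserving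
      (measurePreserving_add_left volume x).quasiMeasurePreserving).enorm.pow_const _).restrict
  have hH := ENNReal.lintegral_mul_norm_pow_le hfx hgx h0.le h1'.le (by ring)
  simp_rw [← ENNReal.rpow_mul, inv_mul_cancel₀ h0.ne', inv_mul_cancel₀ h1'.ne',
    ENNReal.rpow_one] at hH
  rw [setLIntegral_closedBall_sub_left (fun y => ‖f y‖ₑ ^ θ⁻¹),
    setLIntegral_closedBall_add_left (fun y => ‖g y‖ₑ ^ (1 - θ)⁻¹)] at hH
  rw [bilinearMean, hV, setLAverage_eq, setLAverage_eq, ENNReal.div_eq_inv_mul,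
    ENNReal.div_eq_inv_mul, ENNReal.mul_rpow_of_nonneg _ _ h0.le,
    ENNReal.mul_rpow_of_nonneg _ _ h1'.le, mul_mul_mul_comm, ← hVpow]
  simp_rw [enorm_mul]
  gcongr

end Geometry

/-! ### Weights, dual weights and averages -/

section Weights

/-- Hölder's inequality against a weight and its dual weight. -/
theorem lintegral_le_mul_dual {α : Type*} [MeasurableSpace α] {μ : Measure α} {p : ℝ} (hp : 1 < p)
    {w F : α → ℝ≥0∞} (hw : AEMeasurable w μ) (hw0 : ∀ᵐ x ∂μ, 0 < w x) (hwt : ∀ᵐ x ∂μ, w x < ∞)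
    (hF : AEMeasurable F μ) :
    ∫⁻ x, F x ∂μ ≤ (∫⁻ x, F x ^ p * w x ∂μ) ^ (1 / p) *
      (∫⁻ x, w x ^ (1 / (1 - p)) ∂μ) ^ ((p - 1) / p) := by
  have hp0 : 0 < p := by linarith
  have hp1 : 1 - p ≠ 0 := by linarith
  -- Almost everywhere `F` is the product of the `1 / p` power of `F ^ p * w` and the `(p - 1) / p`
  -- power of the dual weight: the exponents of `w` cancel.
  refine le_trans (le_of_eq ?_) (ENNReal.lintegral_mul_norm_pow_le
    ((hF.pow_const p).mul hw) (hw.pow_const (1 / (1 - p))) (by positivity)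
    (div_nonneg (by linarith) hp0.le) (by field_simp; ring))
  refine lintegral_congr_ae ?_
  filter_upwards [hw0, hwt] with x hx0 hxt
  simp only [Pi.mul_apply]
  rw [ENNReal.mul_rpow_of_nonneg _ _ (by positivity), ← ENNReal.rpow_mul, ← ENNReal.rpow_mul,
    mul_assoc, ← ENNReal.rpow_add _ _ hx0.ne' hxt.ne, mul_one_div_cancel hp0.ne',
    ENNReal.rpow_one]
  have : 1 / p + 1 / (1 - p) * ((p - 1) / p) = 0 := by
    field_simp
    ring
  rw [this, ENNReal.rpow_zero, mul_one]

variable {n : ℕ}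

/-- For `p > 1` this is Hölder against the dual weight for normalised measure on `Q`; for `p = 1` it
follows from `w ≥ essInf w` almost everywhere on `Q`. -/
theorem laverage_rpow_le_mul_dualFactor {p q : ℝ} (hp : 1 ≤ p) (hq : 0 < q)
    {w F : (Fin n → ℝ) → ℝ≥0∞} (hw : IsWeight w) (hF : AEMeasurable F volume)
    (Q : Set (Fin n → ℝ)) :
    (⨍⁻ x in Q, F x ∂volume) ^ (p / q) ≤ (⨍⁻ x in Q, F x ^ p * w x ∂volume) ^ (1 / q) *
      dualFactor p q w Q := by
  have hp0 : 0 < p := by linarith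
  rw [dualFactor]
  split_ifs with h
  · subst h
    have hle : ⨍⁻ x in Q, F x ∂volume ≤
        (essInf w (volume.restrict Q))⁻¹ * ⨍⁻ x in Q, F x ^ (1 : ℝ) * w x ∂volume := by
      rw [laverage, laverage, ← lintegral_const_mul'']
      · refine lintegral_mono_ae (Measure.ae_smul_measure ?_ _)
        filter_upwards [ae_essInf_le (f := w) (μ := volume.restrict Q), ae_restrict_of_ae hw.pos,
          ae_restrict_of_ae hw.lt_top] with x hx h0 ht
        rw [ENNReal.rpow_one, mul_left_comm]
        have h1 : 1 ≤ (essInf w (volume.restrict Q))⁻¹ * w x := by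
          rw [← ENNReal.inv_mul_cancel h0.ne' ht.ne]
          gcongr
        calc F x = F x * 1 := (mul_one _).symm
          _ ≤ _ := by gcongr
      · exact ((hF.pow_const 1).mul hw.aemeasurable).restrict.smul_measure _
    calc (⨍⁻ x in Q, F x ∂volume) ^ (1 / q) ≤ ((essInf w (volume.restrict Q))⁻¹ *
          ⨍⁻ x in Q, F x ^ (1 : ℝ) * w x ∂volume) ^ (1 / q) := by gcongr
      _ = _ := by
          rw [ENNReal.mul_rpow_of_nonneg _ _ (by positivity), ENNReal.rpow_neg, ENNReal.inv_rpow,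
            mul_comm]
  · have hp1 : 1 < p := lt_of_le_of_ne hp (Ne.symm h)
    have hH := lintegral_le_mul_dual (μ := (volume.restrict Q univ)⁻¹ • volume.restrict Q) hp1
      (hw.aemeasurable.restrict.smul_measure _)
      (Measure.ae_smul_measure (ae_restrict_of_ae hw.pos) _)
      (Measure.ae_smul_measure (ae_restrict_of_ae hw.lt_top) _) (hF.restrict.smul_measure _)
    have hpq : 0 ≤ p / q := by positivity
    refine (ENNReal.rpow_le_rpow hH hpq).trans (le_of_eq ?_)
    rw [ENNReal.mul_rpow_of_nonneg _ _ hpq, ← ENNReal.rpow_mul, ← ENNReal.rpow_mul, laverage,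
      laverage]
    congr 2 <;> field_simp

theorem le_vectorWeightConst (p p₁ p₂ : ℝ) (w₁ w₂ : (Fin n → ℝ) → ℝ≥0∞) (x : Fin n → ℝ) {r : ℝ}
    (hr : 0 < r) :
    (⨍⁻ y in closedBall x r, productWeight p p₁ p₂ w₁ w₂ y ∂volume) ^ (1 / p) *
      dualFactor p p₁ w₁ (closedBall x r) * dualFactor p p₂ w₂ (closedBall x r) ≤
      vectorWeightConst p p₁ p₂ w₁ w₂ := by
  rw [closedBall_eq_cube x hr.le, vectorWeightConst]
  exact le_iSup_of_le _ (le_iSup₂_of_le (2 * r) (by positivity) le_rfl)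

theorem isWeight_productWeight {p p₁ p₂ : ℝ} (h₁ : 0 ≤ p / p₁) (h₂ : 0 ≤ p / p₂)
    {w₁ w₂ : (Fin n → ℝ) → ℝ≥0∞} (hw₁ : IsWeight w₁) (hw₂ : IsWeight w₂) :
    IsWeight (productWeight p p₁ p₂ w₁ w₂) where
  aemeasurable := (hw₁.aemeasurable.pow_const _).mul (hw₂.aemeasurable.pow_const _)
  pos := by
    filter_upwards [hw₁.pos, hw₂.pos, hw₁.lt_top, hw₂.lt_top] with x a b c d
    exact ENNReal.mul_pos (ENNReal.rpow_pos a c.ne).ne' (ENNReal.rpow_pos b d.ne).ne'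
  lt_top := by
    filter_upwards [hw₁.lt_top, hw₂.lt_top] with x c d
    exact ENNReal.mul_lt_top (ENNReal.rpow_lt_top_of_nonneg h₁ c.ne)
      (ENNReal.rpow_lt_top_of_nonneg h₂ d.ne)

theorem IsWeight.rpow {w : (Fin n → ℝ) → ℝ≥0∞} (hw : IsWeight w) (a : ℝ) :
    IsWeight fun x => w x ^ a where
  aemeasurable := hw.aemeasurable.pow_const _
  pos := by
    filter_upwards [hw.pos, hw.lt_top] with x h0 ht using ENNReal.rpow_pos h0 ht.ne
  lt_top := by
    filter_upwards [hw.pos, hw.lt_top] with x h0 ht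
    exact (ENNReal.rpow_ne_top_of_ne_zero h0.ne' ht.ne).lt_top

theorem IsWeight.absolutelyContinuous {w : (Fin n → ℝ) → ℝ≥0∞} (hw : IsWeight w) :
    volume ≪ weightMeasure w :=
  withDensity_absolutelyContinuous' hw.aemeasurable (hw.pos.mono fun _ h => h.ne')

theorem lintegral_weightMeasure {w F : (Fin n → ℝ) → ℝ≥0∞} (hw : IsWeight w)
    (hF : AEMeasurable F volume) : ∫⁻ x, F x ∂weightMeasure w = ∫⁻ x, F x * w x := by
  rw [weightMeasure, lintegral_withDensity_eq_lintegral_mul₀ hw.aemeasurable hF]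
  simp [mul_comm]

theorem setLIntegral_weightMeasure {w F : (Fin n → ℝ) → ℝ≥0∞} (hw : IsWeight w)
    (hF : AEMeasurable F volume) {Q : Set (Fin n → ℝ)} (hQ : MeasurableSet Q) :
    ∫⁻ x in Q, F x ∂weightMeasure w = ∫⁻ x in Q, F x * w x := by
  rw [weightMeasure, setLIntegral_withDensity_eq_lintegral_mul₀ hw.aemeasurable hF hQ]
  simp [mul_comm]

theorem weightMeasure_closedBall_ne_zero {w : (Fin n → ℝ) → ℝ≥0∞} (hw : IsWeight w)
    (x : Fin n → ℝ) {r : ℝ} (hr : 0 < r) : weightMeasure w (closedBall x r) ≠ 0 := fun h =>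
  volume_closedBall_ne_zero x hr (hw.absolutelyContinuous h)

instance sFinite_weightMeasure (w : (Fin n → ℝ) → ℝ≥0∞) : SFinite (weightMeasure w) :=
  inferInstanceAs (SFinite (volume.withDensity w))

theorem setLAverage_eq_weightMeasure_div (w : (Fin n → ℝ) → ℝ≥0∞) (x : Fin n → ℝ) (r : ℝ) :
    ⨍⁻ y in closedBall x r, w y ∂volume =
      weightMeasure w (closedBall x r) / volume (closedBall x r) := by
  rw [setLAverage_eq, weightMeasure, withDensity_apply _ measurableSet_closedBall]

end Weights

/-! ### Weak type estimate -/

variable {n : ℕ}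

/-- The geometric mean of the averages of `F` and `G` over the cube `closedBall x r`. -/
def geomMean (θ₁ θ₂ : ℝ) (F G : (Fin n → ℝ) → ℝ≥0∞) (r : ℝ) (x : Fin n → ℝ) : ℝ≥0∞ :=
  (⨍⁻ y in closedBall x r, F y ∂volume) ^ θ₁ * (⨍⁻ y in closedBall x r, G y ∂volume) ^ θ₂

theorem rpow_mul_rpow_of_add_eq_one (a : ℝ≥0∞) {s t : ℝ} (hs : 0 ≤ s) (ht : 0 ≤ t)
    (h : s + t = 1) : a ^ s * a ^ t = a := by
  rw [← ENNReal.rpow_add_of_nonneg _ _ hs ht, h, ENNReal.rpow_one]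

/-- The local estimate fed to the covering lemma. The two dual factors produced by Hölder combine
with the average of the product weight into the weight constant; the volume is redistributed using
`p / p₁ + p / p₂ = 1`. -/
theorem weightMeasure_mul_geomMean_rpow_le {p p₁ p₂ : ℝ} (hp : 1 ≤ p) (hp₁ : 0 < p₁)
    (hp₂ : 0 < p₂) (hsum : p / p₁ + p / p₂ = 1) {w₁ w₂ F G : (Fin n → ℝ) → ℝ≥0∞}
    (hw₁ : IsWeight w₁) (hw₂ : IsWeight w₂) (hF : AEMeasurable F volume)
    (hG : AEMeasurable G volume) (x : Fin n → ℝ) {r : ℝ} (hr : 0 < r) :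
    weightMeasure (productWeight p p₁ p₂ w₁ w₂) (closedBall x r) *
        geomMean (p / p₁) (p / p₂) F G r x ^ p ≤
      vectorWeightConst p p₁ p₂ w₁ w₂ ^ p *
        ((∫⁻ y in closedBall x r, F y ^ p ∂weightMeasure w₁) ^ (p / p₁) *
          (∫⁻ y in closedBall x r, G y ^ p ∂weightMeasure w₂) ^ (p / p₂)) := by
  have hp0 : 0 < p := by linarith
  have h₁ : 0 ≤ p / p₁ := by positivity
  have h₂ : 0 ≤ p / p₂ := by positivity
  have hV0 := volume_closedBall_ne_zero x hr
  have hVt := volume_closedBall_ne_top x r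
  have hK := le_vectorWeightConst p p₁ p₂ w₁ w₂ x hr
  have hFle := laverage_rpow_le_mul_dualFactor hp hp₁ hw₁ hF (closedBall x r)
  have hGle := laverage_rpow_le_mul_dualFactor hp hp₂ hw₂ hG (closedBall x r)
  rw [setLIntegral_weightMeasure hw₁ (hF.pow_const p) measurableSet_closedBall,
    setLIntegral_weightMeasure hw₂ (hG.pow_const p) measurableSet_closedBall]
  set a := ⨍⁻ y in closedBall x r, F y ^ p * w₁ y ∂volume with ha
  set b := ⨍⁻ y in closedBall x r, G y ^ p * w₂ y ∂volume with hb
  set W := ⨍⁻ y in closedBall x r, productWeight p p₁ p₂ w₁ w₂ y ∂volume with hW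
  set V := volume (closedBall x r) with hV
  have haV : ∫⁻ y in closedBall x r, F y ^ p * w₁ y = V * a := by
    rw [ha, setLAverage_eq, ENNReal.mul_div_cancel hV0 hVt]
  have hbV : ∫⁻ y in closedBall x r, G y ^ p * w₂ y = V * b := by
    rw [hb, setLAverage_eq, ENNReal.mul_div_cancel hV0 hVt]
  have hWV : weightMeasure (productWeight p p₁ p₂ w₁ w₂) (closedBall x r) = V * W := by
    rw [hW, setLAverage_eq_weightMeasure_div, ENNReal.mul_div_cancel hV0 hVt]
  have hmain : W ^ (1 / p) * geomMean (p / p₁) (p / p₂) F G r x ≤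
      vectorWeightConst p p₁ p₂ w₁ w₂ * (a ^ (1 / p₁) * b ^ (1 / p₂)) := by
    calc W ^ (1 / p) * geomMean (p / p₁) (p / p₂) F G r x
        ≤ W ^ (1 / p) * ((a ^ (1 / p₁) * dualFactor p p₁ w₁ (closedBall x r)) *
            (b ^ (1 / p₂) * dualFactor p p₂ w₂ (closedBall x r))) := by
          rw [geomMean]
          gcongr
      _ = (W ^ (1 / p) * dualFactor p p₁ w₁ (closedBall x r) *
            dualFactor p p₂ w₂ (closedBall x r)) * (a ^ (1 / p₁) * b ^ (1 / p₂)) := by ring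
      _ ≤ _ := by gcongr
  have hpow := ENNReal.rpow_le_rpow hmain hp0.le
  rw [ENNReal.mul_rpow_of_nonneg _ _ hp0.le, ENNReal.mul_rpow_of_nonneg _ _ hp0.le,
    ENNReal.mul_rpow_of_nonneg _ _ hp0.le, ← ENNReal.rpow_mul, ← ENNReal.rpow_mul,
    ← ENNReal.rpow_mul, one_div_mul_cancel hp0.ne', ENNReal.rpow_one, one_div_mul_eq_div,
    one_div_mul_eq_div] at hpow
  rw [haV, hbV, hWV, ENNReal.mul_rpow_of_nonneg _ _ h₁, ENNReal.mul_rpow_of_nonneg _ _ h₂,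
    mul_mul_mul_comm, rpow_mul_rpow_of_add_eq_one _ h₁ h₂ hsum]
  calc _ = V * (W * geomMean (p / p₁) (p / p₂) F G r x ^ p) := by ring
    _ ≤ _ := mul_le_mul_right hpow _
    _ = _ := by ring

theorem aemeasurable_volume_of_memLp {f : (Fin n → ℝ) → ℂ} {w : (Fin n → ℝ) → ℝ≥0∞}
    {q : ℝ≥0∞} (hw : IsWeight w) (hf : MemLp f q (weightMeasure w)) : AEMeasurable f volume :=
  hf.1.aemeasurable.mono_ac hw.absolutelyContinuous

theorem bilinearMean_le_geomMean {p p₁ p₂ : ℝ} (hp : 0 < p) (hp₁ : 0 < p₁)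
    (hp₂ : 0 < p₂) (hsum : p / p₁ + p / p₂ = 1) {f g : (Fin n → ℝ) → ℂ}
    (hf : AEMeasurable f volume) (hg : AEMeasurable g volume) {r : ℝ} (hr : 0 < r)
    (x : Fin n → ℝ) :
    bilinearMean f g r x ≤ geomMean (p / p₁) (p / p₂) (fun y => ‖f y‖ₑ ^ (p₁ / p))
      (fun y => ‖g y‖ₑ ^ (p₂ / p)) r x := by
  have h₁ : 0 < p / p₁ := by positivity
  have h₂ : 0 < p / p₂ := by positivity
  have h := bilinearMean_le hf hg hr x h₁ (by linarith)
  rw [← eq_sub_of_add_eq' hsum, inv_div, inv_div] at h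
  exact h

theorem exists_weakNorm_BM_le {p p₁ p₂ : ℝ} (hp : 1 ≤ p) (hp₁ : 0 < p₁)
    (hp₂ : 0 < p₂) (hsum : p / p₁ + p / p₂ = 1) {w₁ w₂ : (Fin n → ℝ) → ℝ≥0∞}
    (hw₁ : IsWeight w₁) (hw₂ : IsWeight w₂) (hw : vectorWeightConst p p₁ p₂ w₁ w₂ < ∞) :
    ∃ C : ℝ≥0, ∀ f g : (Fin n → ℝ) → ℂ, AEMeasurable f volume → AEMeasurable g volume →
      weakNorm (BM f g) p (weightMeasure (productWeight p p₁ p₂ w₁ w₂)) ≤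
        C * (∫⁻ x, ‖f x‖ₑ ^ p₁ ∂weightMeasure w₁) ^ (1 / p₁) *
          (∫⁻ x, ‖g x‖ₑ ^ p₂ ∂weightMeasure w₂) ^ (1 / p₂) := by
  have hp0 : 0 < p := by linarith
  have h₁ : 0 ≤ p / p₁ := by positivity
  have h₂ : 0 ≤ p / p₂ := by positivity
  obtain ⟨N, hN⟩ := exists_measure_le_of_forall_closedBall_le (Fin n → ℝ)
  set K := vectorWeightConst p p₁ p₂ w₁ w₂ with hK
  refine ⟨((N : ℝ≥0) ^ (1 / p)) * K.toNNReal, fun f g hf hg => iSup₂_le fun t ht => ?_⟩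
  have htp0 : (t : ℝ≥0∞) ^ p ≠ 0 := (ENNReal.rpow_pos (by exact_mod_cast ht) (by simp)).ne'
  have htpt : (t : ℝ≥0∞) ^ p ≠ ∞ := ENNReal.rpow_ne_top_of_nonneg hp0.le (by simp)
  set ν₁ := (weightMeasure w₁).withDensity fun x => ‖f x‖ₑ ^ p₁ with hν₁
  set ν₂ := (weightMeasure w₂).withDensity fun x => ‖g x‖ₑ ^ p₂ with hν₂
  -- The covering lemma is applied to the densities `|f|^p₁ w₁` and `|g|^p₂ w₂`; `1 - p / p₁` is `p
  -- / p₂`.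
  have hS := hN (weightMeasure (productWeight p p₁ p₂ w₁ w₂)) ν₁ ν₂ (p / p₁) h₁ (by linarith)
    (K ^ p / (t : ℝ≥0∞) ^ p) {x | (t : ℝ≥0∞) < BM f g x} ?_
  · rw [← eq_sub_of_add_eq' hsum, hν₁, hν₂, withDensity_apply _ .univ,
      withDensity_apply _ .univ, Measure.restrict_univ, Measure.restrict_univ] at hS
    have hpow := ENNReal.rpow_le_rpow hS (z := 1 / p) (by positivity)
    have hp' : 0 ≤ 1 / p := by positivity
    rw [ENNReal.mul_rpow_of_nonneg _ _ hp', ENNReal.mul_rpow_of_nonneg _ _ hp',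
      ENNReal.mul_rpow_of_nonneg _ _ hp', ENNReal.div_rpow_of_nonneg _ _ hp',
      ← ENNReal.rpow_mul, ← ENNReal.rpow_mul, ← ENNReal.rpow_mul, ← ENNReal.rpow_mul,
      mul_one_div_cancel hp0.ne', ENNReal.rpow_one, ENNReal.rpow_one,
      show p / p₁ * (1 / p) = 1 / p₁ by field_simp,
      show p / p₂ * (1 / p) = 1 / p₂ by field_simp] at hpow
    have ht0 : (t : ℝ≥0∞) ≠ 0 := by exact_mod_cast ht.ne'
    refine (mul_le_mul_right hpow _).trans (le_of_eq ?_)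
    rw [ENNReal.coe_mul, ENNReal.coe_rpow_of_nonneg _ hp', ENNReal.coe_toNNReal hw.ne,
      ENNReal.div_eq_inv_mul]
    calc _ = ((t : ℝ≥0∞) * (t : ℝ≥0∞)⁻¹) * ((N : ℝ≥0∞) ^ (1 / p) * K *
          (∫⁻ x, ‖f x‖ₑ ^ p₁ ∂weightMeasure w₁) ^ (1 / p₁) *
          (∫⁻ x, ‖g x‖ₑ ^ p₂ ∂weightMeasure w₂) ^ (1 / p₂)) := by ring
      _ = _ := by
        rw [ENNReal.mul_inv_cancel ht0 (by simp), one_mul]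
        simp
  intro x hx
  rw [mem_ofPred_eq, BM_eq_iSup_bilinearMean] at hx
  simp only [lt_iSup_iff] at hx
  obtain ⟨q, hq, hlt⟩ := hx
  have hq' : (0 : ℝ) < q := by exact_mod_cast hq
  refine ⟨q, hq', ?_⟩
  have hB := weightMeasure_mul_geomMean_rpow_le hp hp₁ hp₂ hsum hw₁ hw₂
    (hf.enorm.pow_const (p₁ / p)) (hg.enorm.pow_const (p₂ / p)) x hq'
  have hle := ENNReal.rpow_le_rpow (hlt.le.trans
    (bilinearMean_le_geomMean hp0 hp₁ hp₂ hsum hf hg hq' x)) hp0.le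
  rw [← eq_sub_of_add_eq' hsum, hν₁, hν₂, withDensity_apply _ measurableSet_closedBall,
    withDensity_apply _ measurableSet_closedBall, ENNReal.div_eq_inv_mul, mul_assoc,
    ← ENNReal.div_eq_inv_mul, ENNReal.le_div_iff_mul_le (Or.inl htp0) (Or.inl htpt)]
  simp_rw [← ENNReal.rpow_mul, div_mul_cancel₀ _ hp0.ne'] at hB
  exact (mul_le_mul_right hle _).trans hB

/-- The chain `B(x, q) ⊆ B(y, 2q) ⊆ B(x, 3q)` replaces an uncentred maximal function, at the price
of the mass of the tripled ball. -/
theorem setLIntegral_le_centeredMax_mul_of_mem {α : Type*} [MetricSpace α] [MeasurableSpace α]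
    {μ : Measure α} (h : α → ℝ≥0∞) {x y : α} {q : ℚ} (hq : 0 < q) (hy : y ∈ closedBall x q)
    (hfin : μ (closedBall x (3 * q)) ≠ ∞) :
    ∫⁻ z in closedBall x q, h z ∂μ ≤ centeredMax μ h y * μ (closedBall x (3 * q)) := by
  have hsub : closedBall y ((2 * q : ℚ) : ℝ) ⊆ closedBall x (3 * q) := by
    refine closedBall_subset_closedBall' ?_
    rw [mem_closedBall] at hy
    push_cast
    linarith
  have hsub' : closedBall x (q : ℝ) ⊆ closedBall y ((2 * q : ℚ) : ℝ) := by
    refine closedBall_subset_closedBall' ?_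
    rw [mem_closedBall'] at hy
    push_cast
    linarith
  calc ∫⁻ z in closedBall x q, h z ∂μ ≤ ∫⁻ z in closedBall y ((2 * q : ℚ) : ℝ), h z ∂μ :=
        lintegral_mono_set hsub'
    _ ≤ centeredMax μ h y * μ (closedBall y ((2 * q : ℚ) : ℝ)) :=
        setLIntegral_le_centeredMax_mul h y (by linarith) (measure_ne_top_of_subset hsub hfin)
    _ ≤ _ := by gcongr

/-! ### Dual weights: local integrability and averages -/

section DualWeights

variable {p p₁ p₂ : ℝ} {w₁ w₂ : (Fin n → ℝ) → ℝ≥0∞}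

/-- The weight constant in terms of the masses of cubes, for `p > 1`. -/
theorem weightMeasure_div_mul_le (hp : 1 < p) (x : Fin n → ℝ)
    {r : ℝ} (hr : 0 < r) :
    weightMeasure (productWeight p p₁ p₂ w₁ w₂) (closedBall x r) / volume (closedBall x r) *
      ((weightMeasure (fun y => w₁ y ^ (1 / (1 - p))) (closedBall x r) /
          volume (closedBall x r)) ^ (p / p₁) *
        (weightMeasure (fun y => w₂ y ^ (1 / (1 - p))) (closedBall x r) /
          volume (closedBall x r)) ^ (p / p₂)) ^ (p - 1) ≤
      vectorWeightConst p p₁ p₂ w₁ w₂ ^ p := by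
  have hp0 : 0 < p := by linarith
  have hp1 : 0 < p - 1 := by linarith
  have h := ENNReal.rpow_le_rpow (le_vectorWeightConst p p₁ p₂ w₁ w₂ x hr) hp0.le
  rw [dualFactor, dualFactor, if_neg hp.ne', if_neg hp.ne', setLAverage_eq_weightMeasure_div,
    setLAverage_eq_weightMeasure_div, setLAverage_eq_weightMeasure_div,
    ENNReal.mul_rpow_of_nonneg _ _ hp0.le, ENNReal.mul_rpow_of_nonneg _ _ hp0.le,
    ← ENNReal.rpow_mul, ← ENNReal.rpow_mul, ← ENNReal.rpow_mul, one_div_mul_cancel hp0.ne',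
    ENNReal.rpow_one, mul_assoc] at h
  refine (le_of_eq ?_).trans h
  rw [ENNReal.mul_rpow_of_nonneg _ _ hp1.le, ← ENNReal.rpow_mul, ← ENNReal.rpow_mul]
  congr 3 <;> ring

/-- A finite weight constant makes the weight and both dual weights locally integrable. -/
theorem weightMeasure_closedBall_ne_top (hp : 1 < p) (hp₁ : 0 < p₁) (hp₂ : 0 < p₂)
    (hw₁ : IsWeight w₁) (hw₂ : IsWeight w₂) (hw : vectorWeightConst p p₁ p₂ w₁ w₂ < ∞)
    (x : Fin n → ℝ) {r : ℝ} (hr : 0 < r) :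
    weightMeasure (productWeight p p₁ p₂ w₁ w₂) (closedBall x r) ≠ ∞ ∧
      weightMeasure (fun y => w₁ y ^ (1 / (1 - p))) (closedBall x r) ≠ ∞ ∧
      weightMeasure (fun y => w₂ y ^ (1 / (1 - p))) (closedBall x r) ≠ ∞ := by
  have hp0 : 0 < p := by linarith
  have hp1 : 0 < p - 1 := by linarith
  have h₁ : 0 < p / p₁ := by positivity
  have h₂ : 0 < p / p₂ := by positivity
  have hlt := (weightMeasure_div_mul_le (p₁ := p₁) (p₂ := p₂) (w₁ := w₁)
    (w₂ := w₂) hp x hr).trans_lt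
    (ENNReal.rpow_lt_top_of_nonneg hp0.le hw.ne)
  have hV0 := volume_closedBall_ne_zero x hr
  have hVt := volume_closedBall_ne_top x r
  have ha := weightMeasure_closedBall_ne_zero
    (isWeight_productWeight h₁.le h₂.le hw₁ hw₂) x hr
  have hb := weightMeasure_closedBall_ne_zero (hw₁.rpow (1 / (1 - p))) x hr
  have hc := weightMeasure_closedBall_ne_zero (hw₂.rpow (1 / (1 - p))) x hr
  generalize weightMeasure (productWeight p p₁ p₂ w₁ w₂) (closedBall x r) = a at *
  generalize weightMeasure (fun y => w₁ y ^ (1 / (1 - p))) (closedBall x r) = b at *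
  generalize weightMeasure (fun y => w₂ y ^ (1 / (1 - p))) (closedBall x r) = c at *
  generalize volume (closedBall x r) = V at *
  -- All three averages are nonzero, so one infinite average would make the product infinite.
  have ha' : a / V ≠ 0 := by simp [ENNReal.div_eq_zero_iff, ha, hVt]
  have hb' : b / V ≠ 0 := by simp [ENNReal.div_eq_zero_iff, hb, hVt]
  have hc' : c / V ≠ 0 := by simp [ENNReal.div_eq_zero_iff, hc, hVt]
  have hpos : ∀ {z : ℝ≥0∞} {s : ℝ}, 0 < s → z ≠ 0 → z ^ s ≠ 0 := by
    intro z s hs hz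
    simp [ENNReal.rpow_eq_zero_iff, hz, hs.le]
  refine ⟨?_, ?_, ?_⟩ <;> rintro rfl <;> refine hlt.ne ?_ <;> rw [ENNReal.top_div_of_ne_top hVt]
  · exact ENNReal.top_mul (hpos hp1 (mul_ne_zero (hpos h₁ hb') (hpos h₂ hc')))
  · rw [ENNReal.top_rpow_of_pos h₁, ENNReal.top_mul (hpos h₂ hc'), ENNReal.top_rpow_of_pos hp1,
      ENNReal.mul_top ha']
  · rw [ENNReal.top_rpow_of_pos h₂, ENNReal.mul_top (hpos h₁ hb'), ENNReal.top_rpow_of_pos hp1,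
      ENNReal.mul_top ha']

/-- Writing `F dx` as `(F / σ) dσ` brings in the maximal function for `σ`; the factor `3 ^ n` is the
volume ratio of the tripled cube. -/
theorem setLAverage_le_centeredMax_mul {σ F : (Fin n → ℝ) → ℝ≥0∞} (hσ : IsWeight σ)
    (hF : AEMeasurable F volume) {x y : Fin n → ℝ} {q : ℚ} (hq : 0 < q)
    (hy : y ∈ closedBall x q) (hfin : weightMeasure σ (closedBall x (3 * q)) ≠ ∞) :
    ⨍⁻ z in closedBall x q, F z ∂volume ≤ 3 ^ n *
      (centeredMax (weightMeasure σ) (fun z => F z / σ z) y *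
        (weightMeasure σ (closedBall x (3 * q)) / volume (closedBall x (3 * q)))) := by
  have hq' : (0 : ℝ) < q := by exact_mod_cast hq
  have hvol : volume (closedBall x (3 * (q : ℝ))) = 3 ^ n * volume (closedBall x (q : ℝ)) := by
    rw [volume_closedBall x (by positivity), volume_closedBall x hq'.le, mul_left_comm, mul_pow,
      ENNReal.ofReal_mul (by positivity), ENNReal.ofReal_pow (by positivity)]
    simp
  have hint : ∫⁻ z in closedBall x q, F z =
      ∫⁻ z in closedBall x q, F z / σ z ∂weightMeasure σ := by
    rw [setLIntegral_weightMeasure (F := fun z => F z / σ z) hσ (hF.div hσ.aemeasurable)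
      measurableSet_closedBall]
    refine lintegral_congr_ae (ae_restrict_of_ae ?_)
    filter_upwards [hσ.pos, hσ.lt_top] with z h0 ht
    exact (ENNReal.div_mul_cancel h0.ne' ht.ne).symm
  have h3 : (3 : ℝ≥0∞) ^ n * ((3 : ℝ≥0∞) ^ n)⁻¹ = 1 :=
    ENNReal.mul_inv_cancel (by simp) (by simp)
  have hle := setLIntegral_le_centeredMax_mul_of_mem (μ := weightMeasure σ)
    (fun z => F z / σ z) hq hy hfin
  rw [setLAverage_eq, hint, ENNReal.div_eq_inv_mul, ENNReal.div_eq_inv_mul, hvol,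
    ENNReal.mul_inv (by simp) (by simp)]
  calc _ ≤ (volume (closedBall x (q : ℝ)))⁻¹ *
        (centeredMax (weightMeasure σ) (fun z => F z / σ z) y *
          weightMeasure σ (closedBall x (3 * q))) := by gcongr
    _ = (3 : ℝ≥0∞) ^ n * ((3 : ℝ≥0∞) ^ n)⁻¹ * ((volume (closedBall x (q : ℝ)))⁻¹ *
        (centeredMax (weightMeasure σ) (fun z => F z / σ z) y *
          weightMeasure σ (closedBall x (3 * q)))) := by rw [h3, one_mul]
    _ = _ := by ring

end DualWeights

/-! ### Strong type estimate -/

section StrongType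

variable {p p₁ p₂ : ℝ} {w₁ w₂ F G : (Fin n → ℝ) → ℝ≥0∞}

/-- The geometric mean of the centred maximal functions of `F / σ₁` and `G / σ₂` with respect to
the dual weights `σᵢ = wᵢ ^ (1 / (1 - p))`. -/
def dualMax (p p₁ p₂ : ℝ) (w₁ w₂ F G : (Fin n → ℝ) → ℝ≥0∞) (x : Fin n → ℝ) : ℝ≥0∞ :=
  centeredMax (weightMeasure fun y => w₁ y ^ (1 / (1 - p)))
      (fun y => F y / w₁ y ^ (1 / (1 - p))) x ^ (p / p₁) *
    centeredMax (weightMeasure fun y => w₂ y ^ (1 / (1 - p)))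
      (fun y => G y / w₂ y ^ (1 / (1 - p))) x ^ (p / p₂)

theorem aemeasurable_weightMeasure {w f : (Fin n → ℝ) → ℝ≥0∞} (hf : AEMeasurable f volume) :
    AEMeasurable f (weightMeasure w) :=
  hf.mono_ac (withDensity_absolutelyContinuous _ _)

theorem aemeasurable_dualMax (hw₁ : IsWeight w₁) (hw₂ : IsWeight w₂)
    (hF : AEMeasurable F volume) (hG : AEMeasurable G volume) :
    AEMeasurable (dualMax p p₁ p₂ w₁ w₂ F G) volume :=
  ((measurable_centeredMax (aemeasurable_weightMeasure
      (hF.div (hw₁.aemeasurable.pow_const _)))).pow_const _).aemeasurable.mul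
    ((measurable_centeredMax (aemeasurable_weightMeasure
      (hG.div (hw₂.aemeasurable.pow_const _)))).pow_const _).aemeasurable

/-- All masses are compared with those of the tripled cube, where the weight condition is used once.
The left side does not depend on `y`, so the bound can be integrated over the cube. -/
theorem weightMeasure_mul_geomMean_rpow_le_dualMax (hp : 1 < p) (hp₁ : 0 < p₁) (hp₂ : 0 < p₂)
    (hsum : p / p₁ + p / p₂ = 1) (hw₁ : IsWeight w₁) (hw₂ : IsWeight w₂)
    (hw : vectorWeightConst p p₁ p₂ w₁ w₂ < ∞)
    (hF : AEMeasurable F volume) (hG : AEMeasurable G volume) {x y : Fin n → ℝ} {q : ℚ}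
    (hq : 0 < q) (hy : y ∈ closedBall x q) :
    weightMeasure (productWeight p p₁ p₂ w₁ w₂) (closedBall x q) *
        geomMean (p / p₁) (p / p₂) F G q x ^ (p - 1) ≤
      volume (closedBall x (3 * q)) * (vectorWeightConst p p₁ p₂ w₁ w₂ ^ p *
        (3 ^ n * dualMax p p₁ p₂ w₁ w₂ F G y) ^ (p - 1)) := by
  have hp0 : 0 < p := by linarith
  have hp1 : 0 < p - 1 := by linarith
  have h₁ : 0 ≤ p / p₁ := by positivity
  have h₂ : 0 ≤ p / p₂ := by positivity
  have hq' : (0 : ℝ) < 3 * q := by have : (0 : ℝ) < q := by exact_mod_cast hq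
                                   positivity
  obtain ⟨-, hfin₁, hfin₂⟩ := weightMeasure_closedBall_ne_top hp hp₁ hp₂ hw₁ hw₂ hw x hq'
  have hF' := setLAverage_le_centeredMax_mul (hw₁.rpow (1 / (1 - p))) hF hq hy hfin₁
  have hG' := setLAverage_le_centeredMax_mul (hw₂.rpow (1 / (1 - p))) hG hq hy hfin₂
  have hK := weightMeasure_div_mul_le (p₁ := p₁) (p₂ := p₂) (w₁ := w₁) (w₂ := w₂) hp x hq'
  have hV0 := volume_closedBall_ne_zero x hq'
  have hVt := volume_closedBall_ne_top x (3 * q)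
  have hsub : closedBall x (q : ℝ) ⊆ closedBall x (3 * q) :=
    closedBall_subset_closedBall (by linarith)
  have hWle : weightMeasure (productWeight p p₁ p₂ w₁ w₂) (closedBall x q) ≤
      volume (closedBall x (3 * (q : ℝ))) *
        (weightMeasure (productWeight p p₁ p₂ w₁ w₂) (closedBall x (3 * q)) /
          volume (closedBall x (3 * q))) := by
    rw [ENNReal.mul_div_cancel hV0 hVt]
    exact measure_mono hsub
  rw [dualMax]
  set W := weightMeasure (productWeight p p₁ p₂ w₁ w₂) (closedBall x (3 * q)) /
          volume (closedBall x (3 * q))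
  set A := weightMeasure (fun y => w₁ y ^ (1 / (1 - p))) (closedBall x (3 * q)) /
          volume (closedBall x (3 * q))
  set B := weightMeasure (fun y => w₂ y ^ (1 / (1 - p))) (closedBall x (3 * q)) /
          volume (closedBall x (3 * q))
  set V := volume (closedBall x (3 * (q : ℝ)))
  set a := centeredMax (weightMeasure fun y => w₁ y ^ (1 / (1 - p)))
      (fun y => F y / w₁ y ^ (1 / (1 - p))) y
  set b := centeredMax (weightMeasure fun y => w₂ y ^ (1 / (1 - p)))
      (fun y => G y / w₂ y ^ (1 / (1 - p))) y
  have hmean : geomMean (p / p₁) (p / p₂) F G q x ≤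
      (A ^ (p / p₁) * B ^ (p / p₂)) * (3 ^ n * (a ^ (p / p₁) * b ^ (p / p₂))) := by
    calc geomMean (p / p₁) (p / p₂) F G q x
        ≤ (3 ^ n * (a * A)) ^ (p / p₁) * (3 ^ n * (b * B)) ^ (p / p₂) := by
          rw [geomMean]
          gcongr
      _ = (((3 : ℝ≥0∞) ^ n) ^ (p / p₁) * ((3 : ℝ≥0∞) ^ n) ^ (p / p₂)) *
            ((A ^ (p / p₁) * B ^ (p / p₂)) * (a ^ (p / p₁) * b ^ (p / p₂))) := by
          rw [ENNReal.mul_rpow_of_nonneg _ _ h₁, ENNReal.mul_rpow_of_nonneg _ _ h₁,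
            ENNReal.mul_rpow_of_nonneg _ _ h₂, ENNReal.mul_rpow_of_nonneg _ _ h₂]
          ring
      _ = _ := by
          rw [rpow_mul_rpow_of_add_eq_one _ h₁ h₂ hsum]
          ring
  calc _ ≤ (V * W) * ((A ^ (p / p₁) * B ^ (p / p₂)) *
        (3 ^ n * (a ^ (p / p₁) * b ^ (p / p₂)))) ^ (p - 1) := by gcongr
    _ = V * ((W * (A ^ (p / p₁) * B ^ (p / p₂)) ^ (p - 1)) *
        (3 ^ n * (a ^ (p / p₁) * b ^ (p / p₂))) ^ (p - 1)) := by
          rw [ENNReal.mul_rpow_of_nonneg _ _ hp1.le]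
          ring
    _ ≤ _ := by gcongr

/-- Domination of the averages by a maximal function with respect to the product weight. -/
theorem geomMean_rpow_le_centeredMax (hp : 1 < p) (hp₁ : 0 < p₁) (hp₂ : 0 < p₂)
    (hsum : p / p₁ + p / p₂ = 1) (hw₁ : IsWeight w₁) (hw₂ : IsWeight w₂)
    (hw : vectorWeightConst p p₁ p₂ w₁ w₂ < ∞)
    (hF : AEMeasurable F volume) (hG : AEMeasurable G volume) (x : Fin n → ℝ) {q : ℚ}
    (hq : 0 < q) :
    geomMean (p / p₁) (p / p₂) F G q x ^ (p - 1) ≤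
      (3 ^ n * vectorWeightConst p p₁ p₂ w₁ w₂ ^ p * (3 ^ n) ^ (p - 1)) *
        centeredMax (weightMeasure (productWeight p p₁ p₂ w₁ w₂))
          (fun y => dualMax p p₁ p₂ w₁ w₂ F G y ^ (p - 1) / productWeight p p₁ p₂ w₁ w₂ y) x := by
  have hp0 : 0 < p := by linarith
  have hp1 : 0 < p - 1 := by linarith
  have h₁ : 0 ≤ p / p₁ := by positivity
  have h₂ : 0 ≤ p / p₂ := by positivity
  have hq' : (0 : ℝ) < q := by exact_mod_cast hq
  have hwt := isWeight_productWeight h₁ h₂ hw₁ hw₂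
  have hfin := (weightMeasure_closedBall_ne_top hp hp₁ hp₂ hw₁ hw₂ hw x hq').1
  have hH := aemeasurable_dualMax (p := p) (p₁ := p₁) (p₂ := p₂) hw₁ hw₂ hF hG
  have hV0 := volume_closedBall_ne_zero x hq'
  have hVt := volume_closedBall_ne_top x q
  have hvol : volume (closedBall x (3 * (q : ℝ))) = volume (closedBall x (q : ℝ)) * 3 ^ n := by
    rw [volume_closedBall x (by positivity), volume_closedBall x hq'.le, mul_left_comm, mul_pow,
      ENNReal.ofReal_mul (by positivity), ENNReal.ofReal_pow (by positivity)]
    simp [mul_comm]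
  have hint : ∫⁻ y in closedBall x q, dualMax p p₁ p₂ w₁ w₂ F G y ^ (p - 1) =
      ∫⁻ y in closedBall x q, dualMax p p₁ p₂ w₁ w₂ F G y ^ (p - 1) /
        productWeight p p₁ p₂ w₁ w₂ y ∂weightMeasure (productWeight p p₁ p₂ w₁ w₂) := by
    rw [setLIntegral_weightMeasure (F := fun y => dualMax p p₁ p₂ w₁ w₂ F G y ^ (p - 1) /
        productWeight p p₁ p₂ w₁ w₂ y) hwt ((hH.pow_const _).div hwt.aemeasurable)
        measurableSet_closedBall]
    refine lintegral_congr_ae (ae_restrict_of_ae ?_)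
    filter_upwards [hwt.pos, hwt.lt_top] with z h0 ht
    exact (ENNReal.div_mul_cancel h0.ne' ht.ne).symm
  -- Integrating in `y` over the cube produces its volume on the left, which cancels against the
  -- volume of the tripled cube up to `3 ^ n`.
  have hle := setLIntegral_mono' (μ := volume) (measurableSet_closedBall (x := x) (ε := (q : ℝ)))
    fun y hy => weightMeasure_mul_geomMean_rpow_le_dualMax hp hp₁ hp₂ hsum hw₁ hw₂ hw hF hG hq hy
  simp_rw [ENNReal.mul_rpow_of_nonneg _ _ hp1.le] at hle
  rw [setLIntegral_const, lintegral_const_mul'' _ (by fun_prop),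
    lintegral_const_mul'' _ (by fun_prop), lintegral_const_mul'' _ (by fun_prop), hint,
    mul_comm, hvol, mul_assoc, ENNReal.mul_le_mul_iff_right hV0 hVt] at hle
  have hM := setLIntegral_le_centeredMax_mul (fun y => dualMax p p₁ p₂ w₁ w₂ F G y ^ (p - 1) /
    productWeight p p₁ p₂ w₁ w₂ y) x hq hfin
  rw [← ENNReal.mul_le_mul_iff_right (weightMeasure_closedBall_ne_zero hwt x hq') hfin]
  refine hle.trans ?_
  calc _ ≤ 3 ^ n * (vectorWeightConst p p₁ p₂ w₁ w₂ ^ p * ((3 ^ n) ^ (p - 1) *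
        (centeredMax (weightMeasure (productWeight p p₁ p₂ w₁ w₂))
          (fun y => dualMax p p₁ p₂ w₁ w₂ F G y ^ (p - 1) / productWeight p p₁ p₂ w₁ w₂ y) x *
        weightMeasure (productWeight p p₁ p₂ w₁ w₂) (closedBall x q)))) := by gcongr
    _ = _ := by ring

/-- With `σ = w^(1/(1-p))` one has `σ^(1-p) = w`, hence `(F/σ)^p σ = F^p w`. -/
theorem lintegral_div_rpow_dual {w : (Fin n → ℝ) → ℝ≥0∞} (hp : 1 < p) (hw : IsWeight w)
    (hF : AEMeasurable F volume) :
    ∫⁻ x, (F x / w x ^ (1 / (1 - p))) ^ p ∂weightMeasure (fun y => w y ^ (1 / (1 - p))) =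
      ∫⁻ x, F x ^ p ∂weightMeasure w := by
  have hp0 : 0 < p := by linarith
  have hp1 : 1 - p ≠ 0 := by linarith
  rw [lintegral_weightMeasure (F := fun x => (F x / w x ^ (1 / (1 - p))) ^ p)
    (hw.rpow (1 / (1 - p))) ((hF.div (hw.aemeasurable.pow_const _)).pow_const _),
    lintegral_weightMeasure hw (hF.pow_const p)]
  refine lintegral_congr_ae ?_
  filter_upwards [hw.pos, hw.lt_top] with x h0 ht
  rw [ENNReal.div_rpow_of_nonneg _ _ hp0.le, ENNReal.div_eq_inv_mul, ← ENNReal.rpow_mul,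
    ← ENNReal.rpow_neg, mul_right_comm, ← ENNReal.rpow_add _ _ h0.ne' ht.ne, mul_comm]
  congr 1
  rw [show -(1 / (1 - p) * p) + 1 / (1 - p) = 1 by field_simp; ring, ENNReal.rpow_one]

/-- With `w` the product weight, the integrand times `w` is `dualMax^p w^(1/(1-p))`, which splits as
`(M₁^p σ₁)^(p/p₁) (M₂^p σ₂)^(p/p₂)`, where `Mᵢ` is the maximal function for `σᵢ`. Hölder and the
uniform `L^p(σᵢ)` bounds finish. -/
theorem exists_lintegral_dualMax_rpow_le (n : ℕ) (hp : 1 < p) (hp₁ : 0 < p₁) (hp₂ : 0 < p₂)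
    (hsum : p / p₁ + p / p₂ = 1) :
    ∃ C : ℝ≥0, ∀ w₁ w₂ F G : (Fin n → ℝ) → ℝ≥0∞, IsWeight w₁ → IsWeight w₂ →
      AEMeasurable F volume → AEMeasurable G volume →
      ∫⁻ x, (dualMax p p₁ p₂ w₁ w₂ F G x ^ (p - 1) / productWeight p p₁ p₂ w₁ w₂ x) ^ (p / (p - 1))
        ∂weightMeasure (productWeight p p₁ p₂ w₁ w₂) ≤
      C * ((∫⁻ x, F x ^ p ∂weightMeasure w₁) ^ (p / p₁) *
        (∫⁻ x, G x ^ p ∂weightMeasure w₂) ^ (p / p₂)) := by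
  have hp0 : 0 < p := by linarith
  have hp1 : 0 < p - 1 := by linarith
  have hp1' : 1 - p ≠ 0 := by linarith
  have h₁ : 0 ≤ p / p₁ := by positivity
  have h₂ : 0 ≤ p / p₂ := by positivity
  obtain ⟨C, hC⟩ := exists_lintegral_centeredMax_rpow_le (Fin n → ℝ) hp
  refine ⟨C, fun w₁ w₂ F G hw₁ hw₂ hF hG => ?_⟩
  have hwt := isWeight_productWeight h₁ h₂ hw₁ hw₂
  have hH := aemeasurable_dualMax (p := p) (p₁ := p₁) (p₂ := p₂) hw₁ hw₂ hF hG
  have hFd : AEMeasurable (fun y => F y / w₁ y ^ (1 / (1 - p)))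
      (weightMeasure fun y => w₁ y ^ (1 / (1 - p))) :=
    aemeasurable_weightMeasure (hF.div (hw₁.aemeasurable.pow_const _))
  have hGd : AEMeasurable (fun y => G y / w₂ y ^ (1 / (1 - p)))
      (weightMeasure fun y => w₂ y ^ (1 / (1 - p))) :=
    aemeasurable_weightMeasure (hG.div (hw₂.aemeasurable.pow_const _))
  have hC₁ := hC (weightMeasure fun y => w₁ y ^ (1 / (1 - p))) _ hFd
  have hC₂ := hC (weightMeasure fun y => w₂ y ^ (1 / (1 - p))) _ hGd
  have hm₁ := measurable_centeredMax hFd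
  have hm₂ := measurable_centeredMax hGd
  rw [lintegral_div_rpow_dual hp hw₁ hF, lintegral_weightMeasure (hw₁.rpow _)
    (hm₁.pow_const p).aemeasurable] at hC₁
  rw [lintegral_div_rpow_dual hp hw₂ hG, lintegral_weightMeasure (hw₂.rpow _)
    (hm₂.pow_const p).aemeasurable] at hC₂
  rw [lintegral_weightMeasure (F := fun x => (dualMax p p₁ p₂ w₁ w₂ F G x ^ (p - 1) /
    productWeight p p₁ p₂ w₁ w₂ x) ^ (p / (p - 1))) hwt
    (((hH.pow_const _).div hwt.aemeasurable).pow_const _)]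
  have hHol := ENNReal.lintegral_mul_norm_pow_le
    ((hm₁.pow_const p).aemeasurable.mul (hw₁.aemeasurable.pow_const (1 / (1 - p))))
    ((hm₂.pow_const p).aemeasurable.mul (hw₂.aemeasurable.pow_const (1 / (1 - p)))) h₁ h₂ hsum
  calc _ = _ := lintegral_congr_ae ?_
    _ ≤ _ := hHol
    _ ≤ (C * ∫⁻ x, F x ^ p ∂weightMeasure w₁) ^ (p / p₁) *
          (C * ∫⁻ x, G x ^ p ∂weightMeasure w₂) ^ (p / p₂) := by
        simp only [Pi.mul_apply]
        gcongr
    _ = _ := by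
        rw [ENNReal.mul_rpow_of_nonneg _ _ h₁, ENNReal.mul_rpow_of_nonneg _ _ h₂,
          mul_mul_mul_comm, rpow_mul_rpow_of_add_eq_one _ h₁ h₂ hsum]
  filter_upwards [hw₁.pos, hw₁.lt_top, hw₂.pos, hw₂.lt_top, hwt.pos, hwt.lt_top] with
    x h10 h1t h20 h2t h0 ht
  have hq0 : 0 ≤ p / (p - 1) := by positivity
  have hexp : -(p / (p - 1)) + 1 = 1 / (1 - p) := by
    have := hp1.ne'
    field_simp
    ring
  simp only [Pi.mul_apply]
  rw [ENNReal.div_rpow_of_nonneg _ _ hq0, ENNReal.div_eq_inv_mul, ← ENNReal.rpow_neg,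
    mul_right_comm]
  nth_rw 2 [← ENNReal.rpow_one (productWeight p p₁ p₂ w₁ w₂ x)]
  -- The exponent `1 / (1 - p)` is negative, so splitting the power of the product weight needs both
  -- factors nonzero.
  rw [← ENNReal.rpow_add _ _ h0.ne' ht.ne, hexp, ← ENNReal.rpow_mul,
    mul_div_cancel₀ _ hp1.ne', productWeight, dualMax,
    ENNReal.mul_rpow_of_ne_zero (ENNReal.rpow_pos h10 h1t.ne).ne'
      (ENNReal.rpow_pos h20 h2t.ne).ne', ENNReal.mul_rpow_of_nonneg _ _ hp0.le,
    ENNReal.mul_rpow_of_nonneg _ _ h₁, ENNReal.mul_rpow_of_nonneg _ _ h₂]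
  simp only [← ENNReal.rpow_mul]
  rw [mul_comm (p / p₁) (1 / (1 - p)), mul_comm (p / p₂) (1 / (1 - p)), mul_comm (p / p₁) p,
    mul_comm (p / p₂) p]
  ring

theorem exists_lintegral_BM_rpow_le (hp : 1 < p) (hp₁ : 0 < p₁) (hp₂ : 0 < p₂)
    (hsum : p / p₁ + p / p₂ = 1) (hw₁ : IsWeight w₁) (hw₂ : IsWeight w₂)
    (hw : vectorWeightConst p p₁ p₂ w₁ w₂ < ∞) :
    ∃ C : ℝ≥0, ∀ f g : (Fin n → ℝ) → ℂ, AEMeasurable f volume → AEMeasurable g volume →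
      (∫⁻ x, BM f g x ^ p ∂weightMeasure (productWeight p p₁ p₂ w₁ w₂)) ^ (1 / p) ≤
        C * (∫⁻ x, ‖f x‖ₑ ^ p₁ ∂weightMeasure w₁) ^ (1 / p₁) *
          (∫⁻ x, ‖g x‖ₑ ^ p₂ ∂weightMeasure w₂) ^ (1 / p₂) := by
  have hp0 : 0 < p := by linarith
  have hp1 : 0 < p - 1 := by linarith
  have h₁ : 0 ≤ p / p₁ := by positivity
  have h₂ : 0 ≤ p / p₂ := by positivity
  have hwt := isWeight_productWeight h₁ h₂ hw₁ hw₂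
  -- The maximal function for the product weight is used on the dual exponent `p / (p - 1)`.
  have hp' : 1 < p / (p - 1) := by rw [lt_div_iff₀ hp1]; linarith
  obtain ⟨C₁, hC₁⟩ := exists_lintegral_dualMax_rpow_le n hp hp₁ hp₂ hsum
  obtain ⟨C₂, hC₂⟩ := exists_lintegral_centeredMax_rpow_le (Fin n → ℝ) hp'
  set L : ℝ≥0∞ := 3 ^ n * vectorWeightConst p p₁ p₂ w₁ w₂ ^ p * (3 ^ n) ^ (p - 1) with hL
  have hLt : L ≠ ∞ := ENNReal.mul_ne_top (ENNReal.mul_ne_top (by simp)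
    (ENNReal.rpow_ne_top_of_nonneg hp0.le hw.ne)) (ENNReal.rpow_ne_top_of_nonneg hp1.le (by simp))
  have hDt : (L ^ (p / (p - 1)) * (C₂ * C₁)) ^ (1 / p) ≠ ∞ :=
    ENNReal.rpow_ne_top_of_nonneg (by positivity) (ENNReal.mul_ne_top
      (ENNReal.rpow_ne_top_of_nonneg (by positivity) hLt) (by simp [ENNReal.mul_ne_top]))
  refine ⟨((L ^ (p / (p - 1)) * (C₂ * C₁)) ^ (1 / p)).toNNReal, fun f g hf hg => ?_⟩
  rw [ENNReal.coe_toNNReal hDt]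
  set F : (Fin n → ℝ) → ℝ≥0∞ := fun y => ‖f y‖ₑ ^ (p₁ / p) with hFdef
  set G : (Fin n → ℝ) → ℝ≥0∞ := fun y => ‖g y‖ₑ ^ (p₂ / p) with hGdef
  have hF : AEMeasurable F volume := hf.enorm.pow_const _
  have hG : AEMeasurable G volume := hg.enorm.pow_const _
  set k : (Fin n → ℝ) → ℝ≥0∞ := fun y =>
    dualMax p p₁ p₂ w₁ w₂ F G y ^ (p - 1) / productWeight p p₁ p₂ w₁ w₂ y with hk
  have hkm : AEMeasurable k (weightMeasure (productWeight p p₁ p₂ w₁ w₂)) :=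
    aemeasurable_weightMeasure
      (((aemeasurable_dualMax hw₁ hw₂ hF hG).pow_const _).div hwt.aemeasurable)
  -- The domination controls the `(p - 1)`-st power of `BM`, so raising it to `p / (p - 1)` gives
  -- the `p`-th power.
  have hpt : ∀ x, BM f g x ^ p ≤ L ^ (p / (p - 1)) *
      centeredMax (weightMeasure (productWeight p p₁ p₂ w₁ w₂)) k x ^ (p / (p - 1)) := by
    intro x
    have hle : BM f g x ≤
        (L * centeredMax (weightMeasure (productWeight p p₁ p₂ w₁ w₂)) k x) ^ (p - 1)⁻¹ := by
      rw [BM_eq_iSup_bilinearMean]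
      refine iSup₂_le fun q hq => ?_
      refine (bilinearMean_le_geomMean hp0 hp₁ hp₂ hsum hf hg (by exact_mod_cast hq) x).trans ?_
      rw [ENNReal.le_rpow_inv_iff hp1]
      exact geomMean_rpow_le_centeredMax hp hp₁ hp₂ hsum hw₁ hw₂ hw hF hG x hq
    refine (ENNReal.rpow_le_rpow hle hp0.le).trans (le_of_eq ?_)
    rw [← ENNReal.rpow_mul, inv_mul_eq_div, ENNReal.mul_rpow_of_nonneg _ _ (by positivity)]
  have hint : ∫⁻ x, BM f g x ^ p ∂weightMeasure (productWeight p p₁ p₂ w₁ w₂) ≤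
      L ^ (p / (p - 1)) * (C₂ * C₁) * ((∫⁻ x, ‖f x‖ₑ ^ p₁ ∂weightMeasure w₁) ^ (p / p₁) *
        (∫⁻ x, ‖g x‖ₑ ^ p₂ ∂weightMeasure w₂) ^ (p / p₂)) := by
    have hdual := hC₁ w₁ w₂ F G hw₁ hw₂ hF hG
    simp only [hFdef, hGdef, ← ENNReal.rpow_mul, div_mul_cancel₀ _ hp0.ne'] at hdual
    calc _ ≤ _ := lintegral_mono hpt
      _ = L ^ (p / (p - 1)) * ∫⁻ x, centeredMax (weightMeasure (productWeight p p₁ p₂ w₁ w₂)) k x ^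
            (p / (p - 1)) ∂weightMeasure (productWeight p p₁ p₂ w₁ w₂) :=
          lintegral_const_mul _ ((measurable_centeredMax hkm).pow_const _)
      _ ≤ L ^ (p / (p - 1)) * (C₂ * (C₁ * ((∫⁻ x, ‖f x‖ₑ ^ p₁ ∂weightMeasure w₁) ^ (p / p₁) *
            (∫⁻ x, ‖g x‖ₑ ^ p₂ ∂weightMeasure w₂) ^ (p / p₂)))) := by
          gcongr
          refine (hC₂ _ k hkm).trans ?_
          gcongr
      _ = _ := by ring
  refine (ENNReal.rpow_le_rpow hint (z := 1 / p) (by positivity)).trans (le_of_eq ?_)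
  have hpinv : 0 ≤ 1 / p := by positivity
  rw [ENNReal.mul_rpow_of_nonneg _ _ hpinv, ENNReal.mul_rpow_of_nonneg (_ ^ (p / p₁)) _ hpinv,
    ← ENNReal.rpow_mul (∫⁻ x, ‖f x‖ₑ ^ p₁ ∂weightMeasure w₁),
    ← ENNReal.rpow_mul (∫⁻ x, ‖g x‖ₑ ^ p₂ ∂weightMeasure w₂),
    show p / p₁ * (1 / p) = 1 / p₁ by field_simp,
    show p / p₂ * (1 / p) = 1 / p₂ by field_simp, mul_assoc]

end StrongType

/-! ### Translation to `eLpNorm` and conclusion -/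

theorem eLpNorm_ofReal_eq {α ε : Type*} [MeasurableSpace α] [ENorm ε] {μ : Measure α} {q : ℝ}
    (hq : 0 < q) (f : α → ε) :
    eLpNorm f (ENNReal.ofReal q) μ = (∫⁻ x, ‖f x‖ₑ ^ q ∂μ) ^ (1 / q) := by
  rw [eLpNorm_eq_lintegral_rpow_enorm_toReal (by simpa using hq) (by simp),
    ENNReal.toReal_ofReal hq.le]

end BilinearMax

end

theorem mainTheorem11 {n : ℕ} (hn : 0 < n) (p p₁ p₂ : ℝ) (hp₁ : 1 < p₁) (hp₂ : 1 < p₂)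
    (hp : p = p₁ * p₂ / (p₁ + p₂)) (w₁ w₂ : (Fin n → ℝ) → ℝ≥0∞)
    (hw₁ : BilinearMax.IsWeight w₁) (hw₂ : BilinearMax.IsWeight w₂)
    (hw : BilinearMax.vectorWeightConst p p₁ p₂ w₁ w₂ < ∞) :
    (1 ≤ p → ∃ C : ℝ≥0, ∀ f g : (Fin n → ℝ) → ℂ,
      MemLp f (ENNReal.ofReal p₁) (BilinearMax.weightMeasure w₁) →
      MemLp g (ENNReal.ofReal p₂) (BilinearMax.weightMeasure w₂) →
      AEMeasurable (BilinearMax.BM f g)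
          (BilinearMax.weightMeasure (BilinearMax.productWeight p p₁ p₂ w₁ w₂)) ∧
        BilinearMax.weakNorm (BilinearMax.BM f g) p
            (BilinearMax.weightMeasure (BilinearMax.productWeight p p₁ p₂ w₁ w₂)) ≤
          C * eLpNorm f (ENNReal.ofReal p₁) (BilinearMax.weightMeasure w₁)
            * eLpNorm g (ENNReal.ofReal p₂) (BilinearMax.weightMeasure w₂)) ∧
    (1 < p → ∃ C : ℝ≥0, ∀ f g : (Fin n → ℝ) → ℂ,
      MemLp f (ENNReal.ofReal p₁) (BilinearMax.weightMeasure w₁) →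
      MemLp g (ENNReal.ofReal p₂) (BilinearMax.weightMeasure w₂) →
      MemLp (BilinearMax.BM f g) (ENNReal.ofReal p)
          (BilinearMax.weightMeasure (BilinearMax.productWeight p p₁ p₂ w₁ w₂)) ∧
        eLpNorm (BilinearMax.BM f g) (ENNReal.ofReal p)
            (BilinearMax.weightMeasure (BilinearMax.productWeight p p₁ p₂ w₁ w₂)) ≤
          C * eLpNorm f (ENNReal.ofReal p₁) (BilinearMax.weightMeasure w₁)
            * eLpNorm g (ENNReal.ofReal p₂) (BilinearMax.weightMeasure w₂)) := by
  have hp₁' : 0 < p₁ := by linarith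
  have hp₂' : 0 < p₂ := by linarith
  have hp0 : 0 < p := by rw [hp]; positivity
  have hsum : p / p₁ + p / p₂ = 1 := by
    rw [hp]
    field_simp
    ring
  refine ⟨fun h => ?_, fun h => ?_⟩
  · obtain ⟨C, hC⟩ := BilinearMax.exists_weakNorm_BM_le h hp₁' hp₂' hsum hw₁ hw₂ hw
    refine ⟨C, fun f g hf hg => ?_⟩
    have hf' := BilinearMax.aemeasurable_volume_of_memLp hw₁ hf
    have hg' := BilinearMax.aemeasurable_volume_of_memLp hw₂ hg
    refine ⟨(BilinearMax.measurable_BM hf' hg').aemeasurable, ?_⟩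
    rw [BilinearMax.eLpNorm_ofReal_eq hp₁', BilinearMax.eLpNorm_ofReal_eq hp₂']
    exact hC f g hf' hg'
  · obtain ⟨C, hC⟩ := BilinearMax.exists_lintegral_BM_rpow_le h hp₁' hp₂' hsum hw₁ hw₂ hw
    refine ⟨C, fun f g hf hg => ?_⟩
    have hf' := BilinearMax.aemeasurable_volume_of_memLp hw₁ hf
    have hg' := BilinearMax.aemeasurable_volume_of_memLp hw₂ hg
    have hle : eLpNorm (BilinearMax.BM f g) (ENNReal.ofReal p)
        (BilinearMax.weightMeasure (BilinearMax.productWeight p p₁ p₂ w₁ w₂)) ≤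
        C * eLpNorm f (ENNReal.ofReal p₁) (BilinearMax.weightMeasure w₁)
          * eLpNorm g (ENNReal.ofReal p₂) (BilinearMax.weightMeasure w₂) := by
      rw [BilinearMax.eLpNorm_ofReal_eq hp₁', BilinearMax.eLpNorm_ofReal_eq hp₂',
        BilinearMax.eLpNorm_ofReal_eq hp0]
      exact hC f g hf' hg'
    -- Membership in `L^p` follows from the norm bound, whose right side is finite.
    refine ⟨⟨(BilinearMax.measurable_BM hf' hg').aestronglyMeasurable, hle.trans_lt ?_⟩, hle⟩
    exact ENNReal.mul_lt_top (ENNReal.mul_lt_top ENNReal.coe_lt_top hf.2) hg.2
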